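/- Work over $\mathbb{C}$. Let $W$ be a 3-dimensional vector space, let $\iota\colon \mathbb{P}W\hookrightarrow\mathbb{P}^n$, $[w]\mapsto[\ell_0(w):\dots:\ell_n(w)]$, be a linear embedding given by linear forms $\ell_0,\dots,\ell_n\in W^*$, and let $L\subset\mathbb{P}^n$ be its image, a plane. Put $Z=\{[\ell_i] : \ell_i\neq 0\}\subset\mathbb{P}W^*\cong\mathbb{P}^2$, a finite set of points (without multiplicities). Let $L^{\circ 2}$ be the image of $L$ under $[x_0:\dots:x_n]\mapsto[x_0^2:\dots:x_n^2]$, and let $I\subset\mathbb{C}[x_0,\dots,x_n]$ be its defining ideal, i.e. the ideal generated by all homogeneous polynomials vanishing on $L^{\circ 2}$. A conic in $\mathbb{P}W^*$ is given by a nonzero quadratic form up to scalars; it is reducible if that form is a product of two linear forms, and irreducible otherwise. "Minimally generated" means generated by homogeneous forms of which none can be omitted. Then the following hold, where in each case the stated numbers of linear forms are nonnegative. (i) If $Z$ is not contained in any conic, then $I$ is minimally generated by $n-5$ linear forms and $6$ quadratic forms. (ii) Suppose $Z$ is contained in a unique conic $Q$. (a) If $Q$ is irreducible, then $I$ is minimally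 generated by $n-4$ linear forms and $7$ cubic forms. (b) If $Q$ is reducible, then $L^{\circ 2}$ is the complete intersection of $n-4$ hyperplanes and $2$ quadrics, i.e. $I$ is minimally generated by $n-4$ linear forms and $2$ quadratic forms and has height $n-2$. (iii) If $Z$ is contained in several conics, then at least one of the cases (a), (b), (c) below occurs. (a) If $|Z|=3$, then $I$ is minimally generated by $n-2$ linear forms. (b) If $|Z|=4$ and no three points of $Z$ are collinear, then $I$ is minimally generated by $n-3$ linear forms and one quartic form. (c) If $|Z|\ge 4$ and all but one of the points of $Z$ lie on a line, then $I$ is minimally generated by $n-3$ linear forms and one quadratic form. -/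

import Mathlib

open scoped LinearAlgebra.Projectivization

noncomputable section

namespace CoordPower

/-- The complex projective space `ℙⁿ`, with homogeneous coordinates indexed by `Fin (n + 1)`. -/
abbrev ProjSpace (n : ℕ) : Type := ℙ ℂ (Fin (n + 1) → ℂ)

/-- The homogeneous coordinate ring `ℂ[x₀, …, xₙ]` of `ℙⁿ`. -/
abbrev CoordRing (n : ℕ) : Type := MvPolynomial (Fin (n + 1)) ℂ

/-- The morphism `φ_r : ℙⁿ → ℙⁿ`, `[x₀ : … : xₙ] ↦ [x₀ ^ r : … : xₙ ^ r]`, for `r ≥ 1`. -/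
def powMap (n r : ℕ) [NeZero r] : ProjSpace n → ProjSpace n :=
  Projectivization.lift
    (fun v : { v : Fin (n + 1) → ℂ // v ≠ 0 } =>
      Projectivization.mk ℂ (fun i => v.1 i ^ r) (fun h => v.2 (by
        funext i
        exact (pow_eq_zero_iff (NeZero.ne r)).1 (congrFun h i))))
    (by
      rintro ⟨a, ha⟩ ⟨b, hb⟩ t h
      refine (Projectivization.mk_eq_mk_iff' ℂ _ _ _ _).2 ⟨t ^ r, ?_⟩
      funext i
      have hi : a i = t * b i := congrFun h i
      simp [hi, mul_pow])

/-- The coordinate-wise power `X^{∘ r} = φ_r(X)` of a subset `X` of `ℙⁿ`. -/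
def coordPower {n : ℕ} (X : Set (ProjSpace n)) (r : ℕ) [NeZero r] : Set (ProjSpace n) :=
  powMap n r '' X

/-- The defining ideal of a nonempty `X ⊆ ℙⁿ`: all polynomials that vanish at every vector of homogeneous
coordinates of every point of `X`.  As all representatives of a point are taken into account,
`f` belongs to it if and only if every homogeneous component of `f` vanishes on `X`. -/
def definingIdeal {n : ℕ} (X : Set (ProjSpace n)) : Ideal (CoordRing n) where
  carrier := {f | ∀ (v : Fin (n + 1) → ℂ) (hv : v ≠ 0),
    Projectivization.mk ℂ v hv ∈ X → MvPolynomial.eval v f = 0}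
  zero_mem' := fun v _ _ => map_zero (MvPolynomial.eval v)
  add_mem' := fun {f g} hf hg v hv hX => by
    rw [map_add, hf v hv hX, hg v hv hX, add_zero]
  smul_mem' := fun c f hf v hv hX => by
    rw [smul_eq_mul, map_mul, hf v hv hX, mul_zero]

section Planes

variable {W : Type*} [AddCommGroup W] [Module ℂ W]

/-- The linear subspace of `ℙⁿ` that is the image of the linear embedding `ℙ W → ℙⁿ` given by
the injective linear map `ι : W → ℂⁿ⁺¹`. -/
def linearSpace {n : ℕ} (ι : W →ₗ[ℂ] (Fin (n + 1) → ℂ)) (hι : Function.Injective ι) :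
    Set (ProjSpace n) :=
  Set.range (Projectivization.map ι hι)

/-- The `i`-th coordinate `ℓᵢ ∈ W*` of a linear map `ι = (ℓ₀, …, ℓₙ) : W → ℂⁿ⁺¹`. -/
def coordForm {n : ℕ} (ι : W →ₗ[ℂ] (Fin (n + 1) → ℂ)) (i : Fin (n + 1)) : Module.Dual ℂ W :=
  LinearMap.proj i ∘ₗ ι

/-- The point configuration `Z = {[ℓᵢ] | ℓᵢ ≠ 0} ⊆ ℙ W*` of `ι = (ℓ₀, …, ℓₙ)`. -/
def pointConfig {n : ℕ} (ι : W →ₗ[ℂ] (Fin (n + 1) → ℂ)) : Set (ℙ ℂ (Module.Dual ℂ W)) :=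
  {p | ∃ (i : Fin (n + 1)) (hi : coordForm ι i ≠ 0), p = Projectivization.mk ℂ (coordForm ι i) hi}

end Planes

section Conics

variable {V : Type*} [AddCommGroup V] [Module ℂ V]

/-- The zero locus in `ℙ V` of a linear form on `V` (a line if `dim V = 3` and the form is
nonzero). -/
def lineOf (a : Module.Dual ℂ V) : Set (ℙ ℂ V) := {p | a p.rep = 0}

/-- The zero locus in `ℙ V` of a quadratic form on `V` (a conic if `dim V = 3` and the form is
nonzero). -/
def conicOf (q : QuadraticForm ℂ V) : Set (ℙ ℂ V) := {p | q p.rep = 0}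

/-- `Z` lies on the conic `q = 0`, which is given by a nonzero quadratic form up to scalars. -/
def LiesOnConic (Z : Set (ℙ ℂ V)) (q : QuadraticForm ℂ V) : Prop :=
  q ≠ 0 ∧ Z ⊆ conicOf q

/-- `q = 0` is the unique conic through `Z`: every other form of a conic through `Z` is
proportional to `q`. -/
def IsUniqueConic (Z : Set (ℙ ℂ V)) (q : QuadraticForm ℂ V) : Prop :=
  LiesOnConic Z q ∧ ∀ q' : QuadraticForm ℂ V, LiesOnConic Z q' → ∃ c : ℂ, q' = c • q

/-- `Z` lies on (at least) two different conics. -/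
def LiesOnSeveralConics (Z : Set (ℙ ℂ V)) : Prop :=
  ∃ q q' : QuadraticForm ℂ V, LiesOnConic Z q ∧ LiesOnConic Z q' ∧ ∀ c : ℂ, q' ≠ c • q

/-- A conic is reducible if its form is a product of two linear forms. -/
def IsReducibleConic (q : QuadraticForm ℂ V) : Prop :=
  ∃ a b : Module.Dual ℂ V, q = QuadraticMap.linMulLin a b

/-- No three distinct points of `Z` lie on a common line (used for `dim V = 3`). -/
def NoThreeCollinear (Z : Set (ℙ ℂ V)) : Prop :=
  ∀ p₁ ∈ Z, ∀ p₂ ∈ Z, ∀ p₃ ∈ Z, p₁ ≠ p₂ → p₁ ≠ p₃ → p₂ ≠ p₃ →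
    ¬ ∃ a : Module.Dual ℂ V, a ≠ 0 ∧ p₁ ∈ lineOf a ∧ p₂ ∈ lineOf a ∧ p₃ ∈ lineOf a

/-- All but one of the points of `Z` lie on a line (used for `dim V = 3`). -/
def AllButOneCollinear (Z : Set (ℙ ℂ V)) : Prop :=
  ∃ p₀ ∈ Z, ∃ a : Module.Dual ℂ V, a ≠ 0 ∧ Z \ {p₀} ⊆ lineOf a

end Conics

/-- The family `f` consists of homogeneous polynomials of degrees `d`, it generates the ideal
`I`, and none of its members can be left out. -/
structure IsMinimalGenerators {n : ℕ} {κ : Type} (I : Ideal (CoordRing n)) (d : κ → ℕ)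
    (f : κ → CoordRing n) : Prop where
  homogeneous : ∀ i, (f i).IsHomogeneous (d i)
  span_eq : Ideal.span (Set.range f) = I
  irredundant : ∀ i, f i ∉ Ideal.span (f '' {j | j ≠ i})

/-- The ideal `I` is minimally generated by `a` linear forms and `b` forms of degree `d`. -/
def MinimallyGenerated {n : ℕ} (I : Ideal (CoordRing n)) (a b d : ℕ) : Prop :=
  ∃ f : Fin a ⊕ Fin b → CoordRing n,
    IsMinimalGenerators I (Sum.elim (fun _ => 1) (fun _ => d)) f

/-- The subscheme with ideal `I` is the complete intersection of `a` hyperplanes and `b`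
hypersurfaces of degree `d`: these generate `I`, and their number is the codimension. -/
def IsCompleteIntersection {n : ℕ} (I : Ideal (CoordRing n)) (a b d : ℕ) : Prop :=
  MinimallyGenerated I a b d ∧ I.height = ((a + b : ℕ) : ℕ∞)

end CoordPower

end

open CoordPower

/-!
In coordinates on `W` that belong to a basis of the dual space, the defining ideal of the
coordinate-wise square of the plane is the kernel of `ℂ[x₀, …, xₙ] → ℂ[y₀, y₁, y₂]`, `xᵢ ↦ ℓᵢ²`
(`definingIdeal_coordPower_eq_ker`). Up to linear forms and a linear change of variables, which do
not affect the number and degrees of the other generators (`minimallyGenerated_ker_aeval`), this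
kernel only depends on the span of the squares `ℓᵢ²`.

If the basis is chosen among the `ℓᵢ`, that span consists of the squares `y₀², y₁², y₂²` and a
subspace of the span of the mixed products `y₁y₂, y₀y₂, y₀y₁`. A conic through the three coordinate
points has a form `γ₀ v₁v₂ + γ₁ v₀v₂ + γ₂ v₀v₁`, and it passes through `Z` if and only if `γ` is
orthogonal to the subspace (`IsConfigBasis.liesOnConic_iff`). So the conics through `Z` determine
the span (`IsConfigBasis.span_coordSquares`), and after renumbering and rescaling the basis one of
six normal forms remains: `squaresAnd` of no further quadric, `oneProduct`, `sumProducts`,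
`reduciblePair`, `irreduciblePair` or `threeProducts`, the unique conic being reducible exactly if
one of its coefficients vanishes (`isReducibleConic_conicForm_iff`).

The relations of each normal form are found with `ker_eq_of_reduces`: modulo the proposed
generators every polynomial is a combination, over the polynomials in the three variables that map
to `y₀², y₁², y₂²`, of a few fixed polynomials, while `1, y₁y₂, y₀y₂, y₀y₁` are independent over
`ℂ[y₀², y₁², y₂²]` (`eq_zero_of_even_sum`). The images of the fixed polynomials are independent,
except for the irreducible pair, where the missing product `y₀y₁` is available only after
multiplication by a square; this accounts for Koszul relations and hence for cubic generators.

In the reducible case, Krull's theorem bounds the height from above by the number of generators,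
and an explicit chain of kernels of substitutions bounds it from below
(`isCompleteIntersection_ker_aeval`).

If two different conics pass through `Z`, then the vectors of mixed products of all points of `Z`
are proportional, which leaves the three listed configurations (`IsConfigBasis.cases_of_several`).
-/

open MvPolynomial

/-! ### Homogeneous generators -/

/-- The part of degree `d` of an element of a homogeneous ideal whose generators have degree at
least `d` only involves the generators of degree exactly `d`, with constant coefficients. -/
theorem homogeneousComponent_mem_span {σ : Type*} {d : ℕ} {s t : Set (MvPolynomial σ ℂ)}
    (hs : ∀ g ∈ s, g.IsHomogeneous d) (ht : ∀ g ∈ t, ∃ e, d < e ∧ g.IsHomogeneous e)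
    {f : MvPolynomial σ ℂ} (hf : f ∈ Ideal.span (s ∪ t)) :
    homogeneousComponent d f ∈ Submodule.span ℂ s := by
  classical
  have key : ∀ (a g : MvPolynomial σ ℂ), g ∈ s ∪ t →
      homogeneousComponent d (a * g) ∈ Submodule.span ℂ s := by
    let _ := gradedAlgebra (σ := σ) (R := ℂ)
    have hdec : ∀ (p : MvPolynomial σ ℂ) (i : ℕ),
        (DirectSum.decompose (homogeneousSubmodule σ ℂ) p i : MvPolynomial σ ℂ) =
          homogeneousComponent i p := fun p i => decomposition.decompose'_apply p i
    rintro a g (hg | hg)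
    · rw [← hdec, DirectSum.coe_decompose_mul_of_right_mem_of_le (homogeneousSubmodule σ ℂ)
        (hs g hg) le_rfl, hdec, Nat.sub_self, homogeneousComponent_zero, ← smul_eq_C_mul]
      exact Submodule.smul_mem _ _ (Submodule.subset_span hg)
    · obtain ⟨e, hde, he⟩ := ht g hg
      rw [← hdec, DirectSum.coe_decompose_mul_of_right_mem_of_not_le (homogeneousSubmodule σ ℂ)
        he (by omega)]
      exact zero_mem _
  obtain ⟨n, a, g, rfl⟩ := Submodule.mem_span_set'.1 hf
  rw [map_sum]
  exact sum_mem fun i _ => key _ _ (g i).2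

/-- Linearly independent forms of the same degree are an irredundant system of generators. -/
theorem notMem_span_image_ne {σ κ : Type*} {d : ℕ} {g : κ → MvPolynomial σ ℂ}
    (hg : ∀ i, (g i).IsHomogeneous d) (hli : LinearIndependent ℂ g) (i : κ) :
    g i ∉ Ideal.span (g '' {j | j ≠ i}) := by
  intro h
  rw [← Set.union_empty (g '' _)] at h
  have h' := homogeneousComponent_mem_span (d := d) (by rintro _ ⟨j, -, rfl⟩; exact hg j)
    (by simp) h
  rw [homogeneousComponent_eq_self (hg i)] at h'
  exact hli.notMem_span_image (s := {j | j ≠ i}) (by simp) h'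

/-! ### Linear substitutions -/

/-- The linear form with given coefficients. -/
noncomputable abbrev linForm (κ : Type*) [Fintype κ] : (κ → ℂ) →ₗ[ℂ] MvPolynomial κ ℂ :=
  Fintype.linearCombination ℂ X

theorem linForm_isHomogeneous {κ : Type*} [Fintype κ] (c : κ → ℂ) :
    (linForm κ c).IsHomogeneous 1 := by
  rw [Fintype.linearCombination_apply]
  exact IsHomogeneous.sum _ _ _ fun i _ => by
    rw [smul_eq_C_mul]; exact isHomogeneous_C_mul_X _ _

theorem aeval_linForm {κ A : Type*} [Fintype κ] [CommRing A] [Algebra ℂ A] (F : κ → A)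
    (c : κ → ℂ) : aeval F (linForm κ c) = Fintype.linearCombination ℂ F c := by
  simp [Fintype.linearCombination_apply]

theorem linForm_injective {κ : Type*} [Fintype κ] : Function.Injective (linForm κ) :=
  linearIndependent_iff_injective_fintypeLinearCombination.1 (linearIndependent_X κ ℂ)

/-- If all relations between the `Q k` are generated in degrees at least two, then the `Q k` are
linearly independent. -/
theorem linearCombination_injective_of_ker {κ β A : Type*} [Fintype κ] [CommRing A] [Algebra ℂ A]
    {Q : κ → A} {d : ℕ} (hd : 2 ≤ d) {g : β → MvPolynomial κ ℂ} (hg : ∀ i, (g i).IsHomogeneous d)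
    (hker : RingHom.ker (aeval Q : MvPolynomial κ ℂ →ₐ[ℂ] A) = Ideal.span (Set.range g)) :
    Function.Injective (Fintype.linearCombination ℂ Q) := by
  rw [injective_iff_map_eq_zero]
  intro c hc
  rw [← aeval_linForm, ← RingHom.mem_ker, hker, ← Set.empty_union (Set.range g)] at hc
  have h := homogeneousComponent_mem_span (d := 1) (s := ∅) (by simp)
    (by rintro _ ⟨j, rfl⟩; exact ⟨d, by omega, hg j⟩) hc
  rw [homogeneousComponent_eq_self (linForm_isHomogeneous c), Submodule.span_empty,
    Submodule.mem_bot] at h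
  exact linForm_injective (by rw [h, map_zero])

/-- Two systems `S` and `Q` with the same span, the second one linearly independent, are related
by a split surjection of spaces of coefficients. -/
theorem exists_coefficient_maps {m κ A : Type*} [Fintype m] [Fintype κ] [AddCommGroup A]
    [Module ℂ A] {S : m → A} {Q : κ → A}
    (hspan : Submodule.span ℂ (Set.range S) = Submodule.span ℂ (Set.range Q))
    (hQ : Function.Injective (Fintype.linearCombination ℂ Q)) :
    ∃ (M : (m → ℂ) →ₗ[ℂ] (κ → ℂ)) (N : (κ → ℂ) →ₗ[ℂ] (m → ℂ)), M ∘ₗ N = LinearMap.id ∧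
      ∀ c, Fintype.linearCombination ℂ Q (M c) = Fintype.linearCombination ℂ S c := by
  let e := LinearEquiv.ofInjective _ hQ
  have hr : LinearMap.range (Fintype.linearCombination ℂ S) =
      LinearMap.range (Fintype.linearCombination ℂ Q) := by
    rw [Fintype.range_linearCombination, Fintype.range_linearCombination, hspan]
  let M : (m → ℂ) →ₗ[ℂ] (κ → ℂ) := e.symm.toLinearMap ∘ₗ
    (Fintype.linearCombination ℂ S).codRestrict _
      (fun c => hr ▸ LinearMap.mem_range_self _ c)
  have hM : ∀ c, Fintype.linearCombination ℂ Q (M c) = Fintype.linearCombination ℂ S c := by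
    intro c
    have := congrArg Subtype.val (e.apply_symm_apply
      ((Fintype.linearCombination ℂ S).codRestrict _
        (fun c => hr ▸ LinearMap.mem_range_self _ c) c))
    exact this
  have hMs : LinearMap.range M = ⊤ := by
    rw [LinearMap.range_eq_top]
    intro c
    obtain ⟨c', hc'⟩ : Fintype.linearCombination ℂ Q c ∈
        LinearMap.range (Fintype.linearCombination ℂ S) := hr ▸ LinearMap.mem_range_self _ c
    exact ⟨c', hQ ((hM c').trans hc')⟩
  obtain ⟨N, hN⟩ := M.exists_rightInverse_of_surjective hMs
  exact ⟨M, N, hN, hM⟩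

section Substitution

variable {m κ A : Type*} [Fintype m] [Fintype κ]

/-- The homomorphism of polynomial rings that is given on linear forms by a linear map of
coefficients. -/
noncomputable def linSubst [DecidableEq m] (M : (m → ℂ) →ₗ[ℂ] (κ → ℂ)) :
    MvPolynomial m ℂ →ₐ[ℂ] MvPolynomial κ ℂ :=
  aeval fun i => linForm κ (M (Pi.single i 1))

theorem linearCombination_comp_single [DecidableEq m] [AddCommGroup A] [Module ℂ A]
    (T : (m → ℂ) →ₗ[ℂ] A) (c : m → ℂ) :
    Fintype.linearCombination ℂ (fun i => T (Pi.single i 1)) c = T c := by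
  rw [Fintype.linearCombination_apply, LinearMap.pi_apply_eq_sum_univ T c]
  refine Finset.sum_congr rfl fun i _ => ?_
  congr 2
  ext j
  simp [Pi.single_apply, eq_comm]

theorem linSubst_linForm [DecidableEq m] (M : (m → ℂ) →ₗ[ℂ] (κ → ℂ)) (c : m → ℂ) :
    linSubst M (linForm m c) = linForm κ (M c) := by
  refine (aeval_linForm _ c).trans ?_
  exact linearCombination_comp_single (linForm κ ∘ₗ M) c

theorem linForm_single [DecidableEq m] (i : m) : linForm m (Pi.single i 1) = X i := by
  simp [linForm]

theorem linSubst_X [DecidableEq m] (M : (m → ℂ) →ₗ[ℂ] (κ → ℂ)) (i : m) :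
    linSubst M (X i) = linForm κ (M (Pi.single i 1)) := by
  rw [← linForm_single, linSubst_linForm]

theorem linSubst_comp [DecidableEq m] [DecidableEq κ] {M : (m → ℂ) →ₗ[ℂ] (κ → ℂ)}
    {N : (κ → ℂ) →ₗ[ℂ] (m → ℂ)} (h : M ∘ₗ N = LinearMap.id) (f : MvPolynomial κ ℂ) :
    linSubst M (linSubst N f) = f := by
  have : (linSubst M).comp (linSubst N) = AlgHom.id ℂ _ := by
    ext1 k
    rw [AlgHom.comp_apply, linSubst_X, linSubst_linForm,
      show M (N _) = _ from LinearMap.congr_fun h _, LinearMap.id_apply, linForm_single,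
      AlgHom.id_apply]
  exact DFunLike.congr_fun this f

theorem aeval_linSubst [DecidableEq m] [CommRing A] [Algebra ℂ A] {S : m → A} {Q : κ → A}
    {M : (m → ℂ) →ₗ[ℂ] (κ → ℂ)}
    (hM : ∀ c, Fintype.linearCombination ℂ Q (M c) = Fintype.linearCombination ℂ S c)
    (f : MvPolynomial m ℂ) : aeval Q (linSubst M f) = aeval S f := by
  have : (aeval Q).comp (linSubst M) = aeval S := by
    ext1 k
    rw [AlgHom.comp_apply, linSubst_X, aeval_linForm, hM, aeval_X]
    simp
  exact DFunLike.congr_fun this f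

end Substitution

theorem linSubst_isHomogeneous {m κ : Type*} [DecidableEq m] [Fintype κ]
    (M : (m → ℂ) →ₗ[ℂ] (κ → ℂ)) {d : ℕ} {f : MvPolynomial m ℂ} (hf : f.IsHomogeneous d) :
    (linSubst M f).IsHomogeneous d := by
  simpa only [linSubst, one_mul] using
    hf.aeval (fun i => linForm κ (M (Pi.single i 1))) (fun i => linForm_isHomogeneous _)

/-- If the `S i` span the same space as the `Q k`, and the relations between the `Q k` are minimally
generated by `b` forms of degree `d ≥ 2`, then the relations between the `S i` are minimally
generated by linear forms, one for each superfluous `S i`, and `b` forms of degree `d`. -/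
theorem minimallyGenerated_ker_aeval {n : ℕ} {κ A : Type*} [Fintype κ] [DecidableEq κ]
    [CommRing A] [Algebra ℂ A]
    {S : Fin (n + 1) → A} {Q : κ → A}
    (hspan : Submodule.span ℂ (Set.range S) = Submodule.span ℂ (Set.range Q))
    {b d : ℕ} (hd : 2 ≤ d) {g : Fin b → MvPolynomial κ ℂ} (hg : ∀ i, (g i).IsHomogeneous d)
    (hker : RingHom.ker (aeval Q : MvPolynomial κ ℂ →ₐ[ℂ] A) = Ideal.span (Set.range g))
    (hli : LinearIndependent ℂ g) :
    Fintype.card κ ≤ n + 1 ∧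
      MinimallyGenerated (RingHom.ker (aeval S : CoordRing n →ₐ[ℂ] A))
        (n + 1 - Fintype.card κ) b d := by
  obtain ⟨M, N, hMN, hM⟩ := exists_coefficient_maps hspan
    (linearCombination_injective_of_ker hd hg hker)
  have hMN' : ∀ c, M (N c) = c := fun c => LinearMap.congr_fun hMN c
  have hrank := M.finrank_range_add_finrank_ker
  rw [LinearMap.range_eq_top.2 (fun c => ⟨N c, hMN' c⟩), finrank_top,
    Module.finrank_fintype_fun_eq_card, Module.finrank_fintype_fun_eq_card, Fintype.card_fin]
    at hrank
  refine ⟨by omega, ?_⟩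
  let lam := Module.finBasisOfFinrankEq ℂ (LinearMap.ker M)
    (show _ = n + 1 - Fintype.card κ by omega)
  let F : Fin (n + 1 - Fintype.card κ) ⊕ Fin b → CoordRing n :=
    Sum.elim (fun i => linForm _ (lam i).1) (fun j => linSubst N (g j))
  have hF : Set.range F = Set.range (F ∘ Sum.inl) ∪ Set.range (F ∘ Sum.inr) := by
    rw [← Set.Sum.elim_range, Sum.elim_comp_inl_inr]
  have hker0 : ∀ i, linSubst M (F (Sum.inl i)) = 0 := by
    intro i
    change linSubst M (linForm _ (lam i).1) = 0
    rw [linSubst_linForm, (lam i).2, map_zero]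
  have hker1 : ∀ j, linSubst M (F (Sum.inr j)) = g j := fun j => linSubst_comp hMN _
  have hhom : ∀ i, (F i).IsHomogeneous (Sum.elim (fun _ => 1) (fun _ => d) i) := by
    rintro (i | j)
    · exact linForm_isHomogeneous _
    · exact linSubst_isHomogeneous _ (hg j)
  refine ⟨F, hhom, le_antisymm ?_ ?_, ?_⟩
  · rw [Ideal.span_le]
    rintro _ ⟨i | j, rfl⟩
    · rw [SetLike.mem_coe, RingHom.mem_ker, ← aeval_linSubst hM, hker0, map_zero]
    · rw [SetLike.mem_coe, RingHom.mem_ker, ← aeval_linSubst hM, hker1, ← RingHom.mem_ker, hker]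
      exact Ideal.subset_span ⟨j, rfl⟩
  · intro f hf
    have h1 : f - linSubst N (linSubst M f) ∈ Ideal.span (Set.range F) := by
      rw [← Ideal.Quotient.mk_eq_mk_iff_sub_mem]
      have : ((Ideal.Quotient.mkₐ ℂ (Ideal.span (Set.range F))).comp
          ((linSubst N).comp (linSubst M))) = Ideal.Quotient.mkₐ ℂ _ := by
        ext1 i
        rw [AlgHom.comp_apply, AlgHom.comp_apply, linSubst_X, linSubst_linForm,
          Ideal.Quotient.mkₐ_eq_mk, ← linForm_single, Ideal.Quotient.mk_eq_mk_iff_sub_mem,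
          ← map_sub]
        set v := N (M (Pi.single i 1)) - Pi.single i 1 with hv
        have hvk : v ∈ LinearMap.ker M := by
          rw [LinearMap.mem_ker, hv, map_sub, hMN', sub_self]
        have := congrArg (fun w => linForm _ (Subtype.val w)) (lam.sum_repr ⟨v, hvk⟩)
        simp only [Submodule.coe_sum, Submodule.coe_smul, map_sum, map_smul] at this
        rw [← this]
        refine sum_mem fun j _ => ?_
        rw [smul_eq_C_mul]
        exact Ideal.mul_mem_left _ _ (Ideal.subset_span ⟨Sum.inl j, rfl⟩)
      exact (DFunLike.congr_fun this f).symm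
    have h2 : linSubst N (linSubst M f) ∈ Ideal.span (Set.range F) := by
      have hf' : linSubst M f ∈ Ideal.span (Set.range g) := by
        rw [← hker, RingHom.mem_ker, aeval_linSubst hM]
        exact hf
      have := Ideal.mem_map_of_mem (linSubst N) hf'
      rw [Ideal.map_span, ← Set.range_comp] at this
      refine Ideal.span_mono ?_ this
      rw [hF]
      exact Set.subset_union_right
    simpa using add_mem h1 h2
  · rintro (i | j) h
    · -- compare the linear parts
      have h' : F (Sum.inl i) ∈ Ideal.span
          ((F ∘ Sum.inl) '' {j | j ≠ i} ∪ Set.range (F ∘ Sum.inr)) := by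
        refine Ideal.span_mono ?_ h
        rintro _ ⟨j | j, hj, rfl⟩
        · exact Or.inl ⟨j, fun h => hj (by rw [h]), rfl⟩
        · exact Or.inr ⟨j, rfl⟩
      have h2 := homogeneousComponent_mem_span (d := 1)
        (by rintro _ ⟨j, -, rfl⟩; exact hhom (Sum.inl j))
        (by rintro _ ⟨j, rfl⟩; exact ⟨d, by omega, hhom (Sum.inr j)⟩) h'
      rw [homogeneousComponent_eq_self (show (F (Sum.inl i)).IsHomogeneous 1 from hhom (Sum.inl i))]
        at h2
      have hl : LinearIndependent ℂ (F ∘ Sum.inl) :=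
        (lam.linearIndependent.map' (LinearMap.ker M).subtype (Submodule.ker_subtype _)).map'
          (linForm _) (LinearMap.ker_eq_bot.2 linForm_injective)
      exact hl.notMem_span_image (s := {j | j ≠ i}) (by simp) h2
    · have := Ideal.mem_map_of_mem (linSubst M) h
      rw [Ideal.map_span, hker1] at this
      refine notMem_span_image_ne hg hli j (Ideal.span_le.2 ?_ this)
      rintro _ ⟨_, ⟨i | k, hk, rfl⟩, rfl⟩
      · rw [hker0]; exact zero_mem _
      · rw [hker1]; exact Ideal.subset_span ⟨k, fun h => hk (by rw [h]), rfl⟩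

/-! ### Reduction over the ring of polynomials in the squares -/

/-- The system of quadrics `y₀², y₁², y₂²` extended by `r` further ones. -/
noncomputable def squaresAnd {r : ℕ} (m : Fin r → MvPolynomial (Fin 3) ℂ) :
    Fin 3 ⊕ Fin r → MvPolynomial (Fin 3) ℂ :=
  Sum.elim (fun j => X j ^ 2) m

@[simp] theorem squaresAnd_inl {r : ℕ} (m : Fin r → MvPolynomial (Fin 3) ℂ) (j : Fin 3) :
    squaresAnd m (Sum.inl j) = X j ^ 2 := rfl

@[simp] theorem squaresAnd_inr {r : ℕ} (m : Fin r → MvPolynomial (Fin 3) ℂ) (j : Fin r) :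
    squaresAnd m (Sum.inr j) = m j := rfl

theorem aeval_squaresAnd_rename {r : ℕ} (m : Fin r → MvPolynomial (Fin 3) ℂ)
    (P : MvPolynomial (Fin 3) ℂ) : aeval (squaresAnd m) (rename Sum.inl P) = expand 2 P := by
  rw [aeval_rename]
  have : aeval (squaresAnd m ∘ Sum.inl) = expand 2 (R := ℂ) (σ := Fin 3) := by
    ext1 j
    simp
  rw [this]

/-- `f` is congruent modulo `J` to a combination of the `t k` whose coefficients are polynomials in
the first three variables. -/
def Reduces {r : ℕ} {κ : Type*} [Fintype κ] (J : Ideal (MvPolynomial (Fin 3 ⊕ Fin r) ℂ))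
    (t : κ → MvPolynomial (Fin 3 ⊕ Fin r) ℂ) (f : MvPolynomial (Fin 3 ⊕ Fin r) ℂ) : Prop :=
  ∃ P : κ → MvPolynomial (Fin 3) ℂ, f - ∑ k, rename Sum.inl (P k) * t k ∈ J

namespace Reduces

variable {r : ℕ} {κ : Type*} [Fintype κ] {J : Ideal (MvPolynomial (Fin 3 ⊕ Fin r) ℂ)}
    {t : κ → MvPolynomial (Fin 3 ⊕ Fin r) ℂ} {f g : MvPolynomial (Fin 3 ⊕ Fin r) ℂ}

theorem of_mem (h : f ∈ J) : Reduces J t f := ⟨0, by simpa using h⟩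

theorem add (hf : Reduces J t f) (hg : Reduces J t g) : Reduces J t (f + g) := by
  obtain ⟨P, hP⟩ := hf
  obtain ⟨P', hP'⟩ := hg
  refine ⟨P + P', ?_⟩
  convert J.add_mem hP hP' using 1
  simp only [Pi.add_apply, map_add, add_mul, Finset.sum_add_distrib]
  ring

theorem rename_mul (p : MvPolynomial (Fin 3) ℂ) (hf : Reduces J t f) :
    Reduces J t (rename Sum.inl p * f) := by
  obtain ⟨P, hP⟩ := hf
  refine ⟨fun k => p * P k, ?_⟩
  convert J.mul_mem_left (rename Sum.inl p) hP using 1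
  simp only [map_mul, mul_assoc, mul_sub, Finset.mul_sum]

theorem sum {β : Type*} {s : Finset β} {F : β → MvPolynomial (Fin 3 ⊕ Fin r) ℂ}
    (h : ∀ i ∈ s, Reduces J t (F i)) : Reduces J t (∑ i ∈ s, F i) :=
  Finset.sum_induction F (Reduces J t) (fun _ _ => add) (of_mem (zero_mem J)) h

/-- Everything reduces as soon as `1` and the products of the remaining variables with the `t k`
do. -/
theorem all (h1 : Reduces J t 1) (hX : ∀ j k, Reduces J t (X (Sum.inr j) * t k))
    (f : MvPolynomial (Fin 3 ⊕ Fin r) ℂ) : Reduces J t f := by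
  induction f using MvPolynomial.induction_on with
  | C a => simpa using rename_mul (C a) h1
  | add p q hp hq => exact add hp hq
  | mul_X p i hp =>
    rw [mul_comm]
    rcases i with i | j
    · simpa using rename_mul (X i) hp
    · obtain ⟨P, hP⟩ := hp
      have e : X (Sum.inr j) * p = X (Sum.inr j) * (p - ∑ k, rename Sum.inl (P k) * t k) +
          ∑ k, rename Sum.inl (P k) * (X (Sum.inr j) * t k) := by
        rw [mul_sub, Finset.mul_sum]
        simp only [mul_left_comm]
        ring
      rw [e]
      exact add (of_mem (J.mul_mem_left _ hP)) (sum fun k _ => rename_mul _ (hX j k))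

end Reduces

/-- The method by which all kernels below are computed: if every polynomial reduces modulo `J` to a
combination of the `t k`, it suffices to control the syzygies of the images of the `t k` over the
ring of polynomials in the squares. -/
theorem ker_eq_of_reduces {r : ℕ} {m : Fin r → MvPolynomial (Fin 3) ℂ} {κ : Type*} [Fintype κ]
    {J : Ideal (MvPolynomial (Fin 3 ⊕ Fin r) ℂ)} {t : κ → MvPolynomial (Fin 3 ⊕ Fin r) ℂ}
    (hJ : J ≤ RingHom.ker (aeval (squaresAnd m)))
    (h1 : Reduces J t 1) (hX : ∀ j k, Reduces J t (X (Sum.inr j) * t k))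
    (hsyz : ∀ P : κ → MvPolynomial (Fin 3) ℂ,
      ∑ k, expand 2 (P k) * aeval (squaresAnd m) (t k) = 0 →
        ∑ k, rename Sum.inl (P k) * t k ∈ J) :
    RingHom.ker (aeval (squaresAnd m)) = J := by
  refine le_antisymm (fun f hf => ?_) hJ
  obtain ⟨P, hP⟩ := Reduces.all h1 hX f
  have h0 := RingHom.mem_ker.1 (hJ hP)
  rw [map_sub, RingHom.mem_ker.1 hf, zero_sub, neg_eq_zero, map_sum] at h0
  have := hsyz P (by simpa only [map_mul, aeval_squaresAnd_rename] using h0)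
  simpa using J.add_mem hP this

/-- Change of sign of one variable. -/
noncomputable def flipSign (i : Fin 3) : MvPolynomial (Fin 3) ℂ →ₐ[ℂ] MvPolynomial (Fin 3) ℂ :=
  aeval fun j => if j = i then -X j else X j

theorem flipSign_expand (i : Fin 3) (P : MvPolynomial (Fin 3) ℂ) :
    flipSign i (expand 2 P) = expand 2 P := by
  have : (flipSign i).comp (expand 2) = expand 2 := by
    ext1 j
    by_cases h : j = i <;> simp [flipSign, h]
  exact DFunLike.congr_fun this P

theorem flipSign_X (i j : Fin 3) : flipSign i (X j) = if j = i then -X j else X j := by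
  simp [flipSign]

/-- The polynomials `1, y₁y₂, y₀y₂, y₀y₁` are independent over `ℂ[y₀², y₁², y₂²]`: they behave
differently under changes of sign of the variables. -/
theorem eq_zero_of_even_sum {P₀ P₁ P₂ P₃ : MvPolynomial (Fin 3) ℂ}
    (h : expand 2 P₀ + expand 2 P₁ * (X 1 * X 2) + expand 2 P₂ * (X 0 * X 2) +
      expand 2 P₃ * (X 0 * X 1) = 0) : P₀ = 0 ∧ P₁ = 0 ∧ P₂ = 0 ∧ P₃ = 0 := by
  have h0 := congrArg (flipSign 0) h
  have h1 := congrArg (flipSign 1) h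
  have h2 := congrArg (flipSign 2) h
  simp [flipSign_expand, flipSign_X] at h0 h1 h2
  have e0 : (4 : MvPolynomial (Fin 3) ℂ) * expand 2 P₀ = 0 := by linear_combination h + h0 + h1 + h2
  have e1 : (4 * (X 1 * X 2) : MvPolynomial (Fin 3) ℂ) * expand 2 P₁ = 0 := by
    linear_combination h + h0 - h1 - h2
  have e2 : (4 * (X 0 * X 2) : MvPolynomial (Fin 3) ℂ) * expand 2 P₂ = 0 := by
    linear_combination h - h0 + h1 - h2
  have e3 : (4 * (X 0 * X 1) : MvPolynomial (Fin 3) ℂ) * expand 2 P₃ = 0 := by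
    linear_combination h - h0 - h1 + h2
  simpa [X_ne_zero, expand_eq_zero] using And.intro e0 (And.intro e1 (And.intro e2 e3))

theorem reduces_of_eq {r b : ℕ} {κ : Type*} [Fintype κ]
    {g : Fin b → MvPolynomial (Fin 3 ⊕ Fin r) ℂ}
    {t : κ → MvPolynomial (Fin 3 ⊕ Fin r) ℂ} {f : MvPolynomial (Fin 3 ⊕ Fin r) ℂ}
    (P : κ → MvPolynomial (Fin 3) ℂ) (c : Fin b → MvPolynomial (Fin 3 ⊕ Fin r) ℂ)
    (h : f = ∑ k, rename Sum.inl (P k) * t k + ∑ i, c i * g i) :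
    Reduces (Ideal.span (Set.range g)) t f :=
  ⟨P, Ideal.mem_span_range_iff_exists_fun.2 ⟨c, by rw [h]; ring⟩⟩

/-! ### The relations in the six cases -/

/-- The squares of the coordinates are algebraically independent. -/
theorem ker_squares (m : Fin 0 → MvPolynomial (Fin 3) ℂ) :
    RingHom.ker (aeval (squaresAnd m)) =
      Ideal.span (Set.range (Fin.elim0 : Fin 0 → MvPolynomial (Fin 3 ⊕ Fin 0) ℂ)) := by
  refine ker_eq_of_reduces (t := fun _ : Unit => 1) (by simp) ⟨1, by simp⟩ (fun j => j.elim0) ?_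
  intro P h
  simp at h
  simp [(expand_eq_zero two_pos).1 h]

/-- The quadric added to the squares if all points but one lie on a line. -/
noncomputable def oneProduct : Fin 1 → MvPolynomial (Fin 3) ℂ := fun _ => X 0 * X 1

/-- The relation `(y₀y₁)² = y₀² y₁²`. -/
noncomputable def oneProductRel : Fin 1 → MvPolynomial (Fin 3 ⊕ Fin 1) ℂ :=
  fun _ => X (Sum.inr 0) ^ 2 - X (Sum.inl 0) * X (Sum.inl 1)

theorem ker_oneProduct :
    RingHom.ker (aeval (squaresAnd oneProduct)) = Ideal.span (Set.range oneProductRel) := by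
  refine ker_eq_of_reduces (t := ![1, X (Sum.inr 0)]) ?_ ?_ ?_ ?_
  · rw [Ideal.span_le]
    rintro _ ⟨i, rfl⟩
    simp [oneProductRel, oneProduct]
    ring
  · exact reduces_of_eq ![1, 0] 0 (by simp)
  · intro j k
    fin_cases j
    fin_cases k
    · exact reduces_of_eq ![0, 1] 0 (by simp)
    · exact reduces_of_eq ![X 0 * X 1, 0] ![1] (by simp [oneProductRel]; ring)
  · intro P h
    simp [Fin.sum_univ_succ, oneProduct] at h
    obtain ⟨h0, -, -, h1⟩ := eq_zero_of_even_sum (P₀ := P 0) (P₁ := 0) (P₂ := 0) (P₃ := P 1)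
      (by simpa using h)
    simp [Fin.sum_univ_succ, h0, h1]

/-- The quadrics added to the squares if no conic passes through the points. -/
noncomputable def threeProducts : Fin 3 → MvPolynomial (Fin 3) ℂ :=
  ![X 1 * X 2, X 0 * X 2, X 0 * X 1]

/-- The equations of the Veronese surface. -/
noncomputable def threeProductsRel : Fin 6 → MvPolynomial (Fin 3 ⊕ Fin 3) ℂ :=
  ![X (Sum.inr 0) ^ 2 - X (Sum.inl 1) * X (Sum.inl 2),
    X (Sum.inr 1) ^ 2 - X (Sum.inl 0) * X (Sum.inl 2),
    X (Sum.inr 2) ^ 2 - X (Sum.inl 0) * X (Sum.inl 1),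
    X (Sum.inr 0) * X (Sum.inr 1) - X (Sum.inl 2) * X (Sum.inr 2),
    X (Sum.inr 0) * X (Sum.inr 2) - X (Sum.inl 1) * X (Sum.inr 1),
    X (Sum.inr 1) * X (Sum.inr 2) - X (Sum.inl 0) * X (Sum.inr 0)]

/-- The ideal of the Veronese surface is generated by its six quadrics: every polynomial reduces to
a combination of `1` and the three variables that map to the mixed products. -/
theorem ker_threeProducts :
    RingHom.ker (aeval (squaresAnd threeProducts)) = Ideal.span (Set.range threeProductsRel) := by
  refine ker_eq_of_reduces (t := ![1, X (Sum.inr 0), X (Sum.inr 1), X (Sum.inr 2)]) ?_ ?_ ?_ ?_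
  · rw [Ideal.span_le]
    rintro _ ⟨i, rfl⟩
    fin_cases i <;> simp [threeProductsRel, threeProducts] <;> ring
  · exact reduces_of_eq ![1, 0, 0, 0] 0 (by simp [Fin.sum_univ_succ])
  · intro j k
    fin_cases j <;> fin_cases k
    · exact reduces_of_eq ![0, 1, 0, 0] 0 (by simp [Fin.sum_univ_succ])
    · exact reduces_of_eq ![X 1 * X 2, 0, 0, 0] ![1, 0, 0, 0, 0, 0]
        (by simp [Fin.sum_univ_succ, threeProductsRel]; ring)
    · exact reduces_of_eq ![0, 0, 0, X 2] ![0, 0, 0, 1, 0, 0]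
        (by simp [Fin.sum_univ_succ, threeProductsRel])
    · exact reduces_of_eq ![0, 0, X 1, 0] ![0, 0, 0, 0, 1, 0]
        (by simp [Fin.sum_univ_succ, threeProductsRel])
    · exact reduces_of_eq ![0, 0, 1, 0] 0 (by simp [Fin.sum_univ_succ])
    · exact reduces_of_eq ![0, 0, 0, X 2] ![0, 0, 0, 1, 0, 0]
        (by simp [Fin.sum_univ_succ, threeProductsRel]; ring)
    · exact reduces_of_eq ![X 0 * X 2, 0, 0, 0] ![0, 1, 0, 0, 0, 0]
        (by simp [Fin.sum_univ_succ, threeProductsRel]; ring)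
    · exact reduces_of_eq ![0, X 0, 0, 0] ![0, 0, 0, 0, 0, 1]
        (by simp [Fin.sum_univ_succ, threeProductsRel])
    · exact reduces_of_eq ![0, 0, 0, 1] 0 (by simp [Fin.sum_univ_succ])
    · exact reduces_of_eq ![0, 0, X 1, 0] ![0, 0, 0, 0, 1, 0]
        (by simp [Fin.sum_univ_succ, threeProductsRel]; ring)
    · exact reduces_of_eq ![0, X 0, 0, 0] ![0, 0, 0, 0, 0, 1]
        (by simp [Fin.sum_univ_succ, threeProductsRel]; ring)
    · exact reduces_of_eq ![X 0 * X 1, 0, 0, 0] ![0, 0, 1, 0, 0, 0]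
        (by simp [Fin.sum_univ_succ, threeProductsRel]; ring)
  · intro P h
    simp [Fin.sum_univ_succ, threeProducts] at h
    obtain ⟨h0, h1, h2, h3⟩ := eq_zero_of_even_sum (P₀ := P 0) (P₁ := P 1) (P₂ := P 2) (P₃ := P 3)
      (by rw [← h]; ring)
    simp [Fin.sum_univ_succ, h0, h1, h2, h3]

/-- The quadric added to the squares for four points of which no three are collinear. -/
noncomputable def sumProducts : Fin 1 → MvPolynomial (Fin 3) ℂ :=
  fun _ => X 1 * X 2 + X 0 * X 2 + X 0 * X 1

/-- With `s = y₁²y₂² + y₀²y₂² + y₀²y₁²`, the sum `m` of the mixed products satisfies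
`m² - s = 2 y₀y₁y₂ (y₀ + y₁ + y₂)`; squaring this gives the quartic relation. -/
noncomputable def sumProductsRel : Fin 1 → MvPolynomial (Fin 3 ⊕ Fin 1) ℂ := fun _ =>
  (X (Sum.inr 0) ^ 2 - (X (Sum.inl 1) * X (Sum.inl 2) + X (Sum.inl 0) * X (Sum.inl 2) +
      X (Sum.inl 0) * X (Sum.inl 1))) ^ 2
    - 4 * (X (Sum.inl 0) * X (Sum.inl 1) * X (Sum.inl 2) *
      (X (Sum.inl 0) + X (Sum.inl 1) + X (Sum.inl 2) + 2 * X (Sum.inr 0)))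

theorem X_sub_X_ne_zero {i j : Fin 3} (h : i ≠ j) : (X i - X j : MvPolynomial (Fin 3) ℂ) ≠ 0 :=
  sub_ne_zero.2 fun e => h (X_injective e)

/-- The powers `1, m, m², m³` of the sum of the mixed products are independent over
`ℂ[y₀², y₁², y₂²]`, so its quartic equation generates all relations. -/
theorem ker_sumProducts :
    RingHom.ker (aeval (squaresAnd sumProducts)) = Ideal.span (Set.range sumProductsRel) := by
  refine ker_eq_of_reduces
    (t := ![1, X (Sum.inr 0), X (Sum.inr 0) ^ 2, X (Sum.inr 0) ^ 3]) ?_ ?_ ?_ ?_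
  · rw [Ideal.span_le]
    rintro _ ⟨i, rfl⟩
    simp [sumProductsRel, sumProducts, map_ofNat]
    ring
  · exact reduces_of_eq ![1, 0, 0, 0] 0 (by simp [Fin.sum_univ_succ])
  · intro j k
    fin_cases j
    fin_cases k
    · exact reduces_of_eq ![0, 1, 0, 0] 0 (by simp [Fin.sum_univ_succ])
    · exact reduces_of_eq ![0, 0, 1, 0] 0 (by simp [Fin.sum_univ_succ]; ring)
    · exact reduces_of_eq ![0, 0, 0, 1] 0 (by simp [Fin.sum_univ_succ]; ring)
    · refine reduces_of_eq ![4 * (X 0 * X 1 * X 2) * (X 0 + X 1 + X 2) -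
          (X 1 * X 2 + X 0 * X 2 + X 0 * X 1) ^ 2, 8 * (X 0 * X 1 * X 2),
          2 * (X 1 * X 2 + X 0 * X 2 + X 0 * X 1), 0] ![1] ?_
      simp [Fin.sum_univ_succ, sumProductsRel, map_ofNat]
      ring
  · intro P h
    simp [Fin.sum_univ_succ, sumProducts] at h
    obtain ⟨h0, h1, h2, h3⟩ := eq_zero_of_even_sum
      (P₀ := P 0 + (X 1 * X 2 + X 0 * X 2 + X 0 * X 1) * P 2 + 6 * (X 0 * X 1 * X 2) * P 3)
      (P₁ := P 1 + 2 * X 0 * P 2 +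
        ((X 1 * X 2 + X 0 * X 2 + X 0 * X 1) + 2 * X 0 * (X 1 + X 2)) * P 3)
      (P₂ := P 1 + 2 * X 1 * P 2 +
        ((X 1 * X 2 + X 0 * X 2 + X 0 * X 1) + 2 * X 1 * (X 0 + X 2)) * P 3)
      (P₃ := P 1 + 2 * X 2 * P 2 +
        ((X 1 * X 2 + X 0 * X 2 + X 0 * X 1) + 2 * X 2 * (X 0 + X 1)) * P 3)
      (by rw [← h]; simp [map_ofNat]; ring)
    have e1 : P 2 + X 2 * P 3 = 0 := by
      have : 2 * (X 0 - X 1) * (P 2 + X 2 * P 3) = 0 := by linear_combination h1 - h2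
      simpa [X_sub_X_ne_zero] using this
    have e2 : P 2 + X 0 * P 3 = 0 := by
      have : 2 * (X 1 - X 2) * (P 2 + X 0 * P 3) = 0 := by linear_combination h2 - h3
      simpa [X_sub_X_ne_zero] using this
    have e3 : P 3 = 0 := by
      have : (X 0 - X 2) * P 3 = 0 := by linear_combination e2 - e1
      simpa [X_sub_X_ne_zero] using this
    have e4 : P 2 = 0 := by simpa [e3] using e1
    have e5 : P 1 = 0 := by simpa [e3, e4] using h1
    have e6 : P 0 = 0 := by simpa [e3, e4] using h0
    simp [Fin.sum_univ_succ, e3, e4, e5, e6]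

/-- The quadrics added to the squares if there is a unique conic through the points, namely the
reducible one with mixed coefficients `α, β, 0`: together they span the orthogonal complement of
`(α, β, 0)` in the space of mixed products. -/
noncomputable def reduciblePair (α β : ℂ) : Fin 2 → MvPolynomial (Fin 3) ℂ :=
  ![X 0 * X 1, C β * (X 1 * X 2) - C α * (X 0 * X 2)]

/-- The quadratic equations of the two members of a reducible pair over `ℂ[y₀², y₁², y₂²]`. -/
noncomputable def reduciblePairRel (α β : ℂ) : Fin 2 → MvPolynomial (Fin 3 ⊕ Fin 2) ℂ :=
  ![X (Sum.inr 0) ^ 2 - X (Sum.inl 0) * X (Sum.inl 1),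
    X (Sum.inr 1) ^ 2 - X (Sum.inl 2) * (C (β ^ 2) * X (Sum.inl 1) + C (α ^ 2) * X (Sum.inl 0)
      - C (2 * α * β) * X (Sum.inr 0))]

/-- The two quadrics `m₀, m₁` of a reducible pair, together with `1` and `m₀m₁`, are independent
over `ℂ[y₀², y₁², y₂²]`. -/
theorem ker_reduciblePair {α β : ℂ} (h0 : α ≠ 0 ∨ β ≠ 0) :
    RingHom.ker (aeval (squaresAnd (reduciblePair α β))) =
      Ideal.span (Set.range (reduciblePairRel α β)) := by
  refine ker_eq_of_reduces
    (t := ![1, X (Sum.inr 0), X (Sum.inr 1), X (Sum.inr 0) * X (Sum.inr 1)]) ?_ ?_ ?_ ?_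
  · rw [Ideal.span_le]
    rintro _ ⟨i, rfl⟩
    fin_cases i <;> simp [reduciblePairRel, reduciblePair, map_ofNat] <;> ring
  · exact reduces_of_eq ![1, 0, 0, 0] 0 (by simp [Fin.sum_univ_succ])
  · intro j k
    fin_cases j <;> fin_cases k
    · exact reduces_of_eq ![0, 1, 0, 0] 0 (by simp [Fin.sum_univ_succ])
    · exact reduces_of_eq ![X 0 * X 1, 0, 0, 0] ![1, 0]
        (by simp [Fin.sum_univ_succ, reduciblePairRel, map_ofNat]; ring)
    · exact reduces_of_eq ![0, 0, 0, 1] 0 (by simp [Fin.sum_univ_succ])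
    · exact reduces_of_eq ![0, 0, X 0 * X 1, 0] ![X (Sum.inr 1), 0]
        (by simp [Fin.sum_univ_succ, reduciblePairRel, map_ofNat]; ring)
    · exact reduces_of_eq ![0, 0, 1, 0] 0 (by simp [Fin.sum_univ_succ])
    · exact reduces_of_eq ![0, 0, 0, 1] 0 (by simp [Fin.sum_univ_succ]; ring)
    · refine reduces_of_eq ![X 2 * (C (β ^ 2) * X 1 + C (α ^ 2) * X 0),
        -(C (2 * α * β) * X 2), 0, 0] ![0, 1] ?_
      simp [Fin.sum_univ_succ, reduciblePairRel, map_ofNat]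
      ring
    · refine reduces_of_eq ![-(C (2 * α * β) * X 2 * (X 0 * X 1)),
        X 2 * (C (β ^ 2) * X 1 + C (α ^ 2) * X 0), 0, 0]
        ![-(C (2 * α * β) * X (Sum.inl 2)), X (Sum.inr 0)] ?_
      simp [Fin.sum_univ_succ, reduciblePairRel, map_ofNat]
      ring
  · intro P h
    simp [Fin.sum_univ_succ, reduciblePair] at h
    obtain ⟨h1, h2, h3, h4⟩ := eq_zero_of_even_sum (P₀ := P 0) (P₃ := P 1)
      (P₁ := C β * P 2 - C α * X 0 * P 3) (P₂ := C β * X 1 * P 3 - C α * P 2)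
      (by rw [← h]; simp; ring)
    have e : (C (β ^ 2) * X 1 - C (α ^ 2) * X 0 : MvPolynomial (Fin 3) ℂ) ≠ 0 := by
      intro e
      have e1 := congrArg (eval ![1, 0, 0]) e
      have e2 := congrArg (eval ![0, 1, 0]) e
      simp at e1 e2
      tauto
    have e3 : P 3 = 0 := by
      have : (C (β ^ 2) * X 1 - C (α ^ 2) * X 0) * P 3 = 0 := by
        simp only [map_pow]
        linear_combination C α * h2 + C β * h3
      exact (mul_eq_zero.1 this).resolve_left e
    have e2 : P 2 = 0 := by
      rcases h0 with h0 | h0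
      · simpa [e3, h0] using h3
      · simpa [e3, h0] using h2
    simp [Fin.sum_univ_succ, e3, e2, h1, h4]

/-- The quadrics added to the squares if there is a unique conic through the points and it is
irreducible, with mixed coefficients `1, 1, 1`. -/
noncomputable def irreduciblePair : Fin 2 → MvPolynomial (Fin 3) ℂ :=
  ![X 1 * X 2 - X 0 * X 2, X 0 * X 2 - X 0 * X 1]

/-- Quadrics whose images are `2 y₀y₁` times `y₀²`, `y₁²` and `y₂²`. The product `y₀y₁` is
not in the span of the system, but these multiples of it are in the algebra it generates. -/
noncomputable def mulQuadric : Fin 3 → MvPolynomial (Fin 3 ⊕ Fin 2) ℂ :=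
  ![X (Sum.inl 0) * X (Sum.inl 2) + X (Sum.inl 0) * X (Sum.inl 1)
      - 2 * (X (Sum.inl 0) * (X (Sum.inr 0) + X (Sum.inr 1))) - X (Sum.inr 1) ^ 2,
    X (Sum.inl 0) * X (Sum.inl 1) + X (Sum.inl 1) * X (Sum.inl 2) - X (Sum.inr 0) ^ 2
      - X (Sum.inr 1) ^ 2 - 2 * (X (Sum.inl 1) * X (Sum.inr 1))
      - 2 * (X (Sum.inr 0) * X (Sum.inr 1)),
    X (Sum.inl 1) * X (Sum.inl 2) + X (Sum.inl 0) * X (Sum.inl 2) - X (Sum.inr 0) ^ 2]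

/-- The cubic relation that expresses the product of the first member of the irreducible pair with
`mulQuadric i`. -/
noncomputable def mulRel₀ (i : Fin 3) : MvPolynomial (Fin 3 ⊕ Fin 2) ℂ :=
  X (Sum.inr 0) * mulQuadric i - (2 * (X (Sum.inl i) *
    (X (Sum.inl 1) * X (Sum.inr 1) - X (Sum.inl 0) * (X (Sum.inr 0) + X (Sum.inr 1)))) +
      (X (Sum.inl 1) - X (Sum.inl 0)) * mulQuadric i)

/-- The cubic relation that expresses the product of the second member of the irreducible pair with
`mulQuadric i`. -/
noncomputable def mulRel₁ (i : Fin 3) : MvPolynomial (Fin 3 ⊕ Fin 2) ℂ :=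
  X (Sum.inr 1) * mulQuadric i - (2 * (X (Sum.inl i) *
    (X (Sum.inl 0) * (X (Sum.inr 0) + X (Sum.inr 1)) - X (Sum.inl 0) * X (Sum.inl 1))) +
      X (Sum.inl 0) * mulQuadric i)

/-- The three Koszul relations between the `mulQuadric i` and four of their multiplication
relations. The multiplication relations of `mulQuadric 1` are combinations of these. -/
noncomputable def irreduciblePairRel : Fin 7 → MvPolynomial (Fin 3 ⊕ Fin 2) ℂ :=
  ![X (Sum.inl 0) * mulQuadric 1 - X (Sum.inl 1) * mulQuadric 0,
    X (Sum.inl 0) * mulQuadric 2 - X (Sum.inl 2) * mulQuadric 0,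
    X (Sum.inl 1) * mulQuadric 2 - X (Sum.inl 2) * mulQuadric 1,
    mulRel₀ 2, mulRel₁ 2, mulRel₀ 0, mulRel₁ 0]

theorem aeval_mulQuadric (i : Fin 3) :
    aeval (squaresAnd irreduciblePair) (mulQuadric i) = 2 * (X i ^ 2 * (X 0 * X 1)) := by
  fin_cases i <;> simp [mulQuadric, irreduciblePair, map_ofNat] <;> ring

/-- The Koszul syzygies generate all linear syzygies of the three variables. -/
theorem exists_koszul {p q s : MvPolynomial (Fin 3) ℂ}
    (h : X 0 * p + X 1 * q + X 2 * s = 0) : ∃ u v w : MvPolynomial (Fin 3) ℂ,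
      p = X 1 * w - X 2 * u ∧ q = -X 0 * w - X 2 * v ∧ s = X 0 * u + X 1 * v := by
  have hs : s ∈ Ideal.span {(X 0 : MvPolynomial (Fin 3) ℂ), X 1} := by
    -- setting the first two variables to zero does not change residues modulo this ideal
    let θ : MvPolynomial (Fin 3) ℂ →ₐ[ℂ] MvPolynomial (Fin 3) ℂ := aeval ![0, 0, X 2]
    have hθ : θ s = 0 := by
      have := congrArg θ h
      simpa [θ] using this
    have e : (Ideal.Quotient.mkₐ ℂ (Ideal.span {(X 0 : MvPolynomial (Fin 3) ℂ), X 1})).comp θ =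
        Ideal.Quotient.mkₐ ℂ _ := by
      ext1 j
      fin_cases j
      · simpa [θ] using (Ideal.Quotient.eq_zero_iff_mem.2
          (Ideal.subset_span (Set.mem_insert (X 0 : MvPolynomial (Fin 3) ℂ) {X 1}))).symm
      · simpa [θ] using (Ideal.Quotient.eq_zero_iff_mem.2
          (Ideal.subset_span (Set.mem_insert_of_mem (X 0) (Set.mem_singleton
            (X 1 : MvPolynomial (Fin 3) ℂ))))).symm
      · simp [θ]
    rw [← Ideal.Quotient.eq_zero_iff_mem, ← Ideal.Quotient.mkₐ_eq_mk ℂ, ← e, AlgHom.comp_apply,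
      hθ, map_zero]
  obtain ⟨u, v, rfl⟩ := Ideal.mem_span_pair.1 hs
  have h' : X 0 * (p + X 2 * u) + X 1 * (q + X 2 * v) = 0 := by linear_combination h
  obtain ⟨w, hw⟩ : X 1 ∣ p + X 2 * u := by
    have hd : X 1 ∣ X 0 * (p + X 2 * u) := ⟨-(q + X 2 * v), by linear_combination h'⟩
    exact (X_dvd_mul_iff.1 hd).resolve_left (by simp [X_dvd_X])
  refine ⟨u, v, w, by linear_combination hw, ?_, by ring⟩
  have : X 1 * (q + X 2 * v + X 0 * w) = 0 := by linear_combination h' - X 0 * hw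
  have := (mul_eq_zero.1 this).resolve_left (X_ne_zero _)
  linear_combination this

theorem irreduciblePairRel_le :
    Ideal.span (Set.range irreduciblePairRel) ≤
      RingHom.ker (aeval (squaresAnd irreduciblePair)) := by
  have h0 : ∀ i, aeval (squaresAnd irreduciblePair) (mulRel₀ i) = 0 := by
    intro i
    simp only [mulRel₀, map_sub, map_mul, map_add, aeval_mulQuadric, aeval_X, squaresAnd_inl,
      squaresAnd_inr, map_ofNat]
    simp only [irreduciblePair, Matrix.cons_val_zero, Matrix.cons_val_one]
    ring
  have h1 : ∀ i, aeval (squaresAnd irreduciblePair) (mulRel₁ i) = 0 := by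
    intro i
    simp only [mulRel₁, map_sub, map_mul, map_add, aeval_mulQuadric, aeval_X, squaresAnd_inl,
      squaresAnd_inr, map_ofNat]
    simp only [irreduciblePair, Matrix.cons_val_zero, Matrix.cons_val_one]
    ring
  rw [Ideal.span_le]
  rintro _ ⟨i, rfl⟩
  rw [SetLike.mem_coe, RingHom.mem_ker]
  fin_cases i
  iterate 3
    simp only [irreduciblePairRel, Fin.zero_eta, Fin.mk_one, Fin.reduceFinMk, Matrix.cons_val,
      map_sub, map_mul, aeval_mulQuadric, aeval_X, squaresAnd_inl]
    ring
  · exact h0 2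
  · exact h1 2
  · exact h0 0
  · exact h1 0

/-- Every polynomial reduces to a combination of `1`, the two members of the pair and the three
`mulQuadric i`. As the images of the latter are `2 y₀y₁` times the squares, the remaining syzygies
are the Koszul ones. -/
theorem ker_irreduciblePair :
    RingHom.ker (aeval (squaresAnd irreduciblePair)) =
      Ideal.span (Set.range irreduciblePairRel) := by
  refine ker_eq_of_reduces
    (t := ![1, X (Sum.inr 0), X (Sum.inr 1), mulQuadric 0, mulQuadric 1, mulQuadric 2])
    irreduciblePairRel_le ?_ ?_ ?_
  · exact reduces_of_eq ![1, 0, 0, 0, 0, 0] 0 (by simp [Fin.sum_univ_succ])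
  · -- a version of `reduces_of_eq` with constant coefficients of the generators; the last two
    -- Koszul relations are not needed
    have hg : ∀ (f : MvPolynomial (Fin 3 ⊕ Fin 2) ℂ) (P : Fin 6 → MvPolynomial (Fin 3) ℂ)
        (c : Fin 7 → ℂ), f = rename Sum.inl (P 0) + rename Sum.inl (P 1) * X (Sum.inr 0) +
          rename Sum.inl (P 2) * X (Sum.inr 1) + rename Sum.inl (P 3) * mulQuadric 0 +
          rename Sum.inl (P 4) * mulQuadric 1 + rename Sum.inl (P 5) * mulQuadric 2 +
          (C (c 0) * (X (Sum.inl 0) * mulQuadric 1 - X (Sum.inl 1) * mulQuadric 0) +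
          C (c 3) * mulRel₀ 2 + C (c 4) * mulRel₁ 2 + C (c 5) * mulRel₀ 0 +
          C (c 6) * mulRel₁ 0) → c 1 = 0 → c 2 = 0 →
          Reduces (Ideal.span (Set.range irreduciblePairRel))
            ![1, X (Sum.inr 0), X (Sum.inr 1), mulQuadric 0, mulQuadric 1, mulQuadric 2] f := by
      intro f P c h h1 h2
      refine reduces_of_eq P (fun i => C (c i)) ?_
      rw [h, Fin.sum_univ_six, Fin.sum_univ_seven]
      simp only [irreduciblePairRel, Matrix.cons_val, h1, h2, map_zero]
      ring
    -- the definition of `mulQuadric 1`, solved for the product of the two members of the pair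
    have hS2 : X (Sum.inr 0) * X (Sum.inr 1) =
        -(X (Sum.inl 0) * X (Sum.inl 2)) - X (Sum.inl 1) * X (Sum.inr 1) +
        X (Sum.inl 0) * (X (Sum.inr 0) + X (Sum.inr 1)) +
        C (2⁻¹) * (mulQuadric 0 - mulQuadric 1 + mulQuadric 2) := by
      have h2 : C (2⁻¹ : ℂ) * 2 = (1 : MvPolynomial (Fin 3 ⊕ Fin 2) ℂ) := by
        rw [← map_ofNat C, ← C_mul]; norm_num
      simp only [mulQuadric, Matrix.cons_val]
      linear_combination (-(X (Sum.inl 0) * X (Sum.inl 2)) - X (Sum.inl 1) * X (Sum.inr 1) +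
        X (Sum.inl 0) * (X (Sum.inr 0) + X (Sum.inr 1)) - X (Sum.inr 0) * X (Sum.inr 1)) * h2
    intro j k
    fin_cases j <;> fin_cases k
    · refine hg _ ![0, 1, 0, 0, 0, 0] 0 ?_ rfl rfl
      simp
    · refine hg _ ![X 1 * X 2 + X 0 * X 2, 0, 0, 0, 0, -1] 0 ?_ rfl rfl
      simp [mulQuadric]
      ring
    · refine hg _ ![-(X 0 * X 2), X 0, X 0 - X 1, C 2⁻¹, -C 2⁻¹, C 2⁻¹] 0 ?_ rfl rfl
      simp [hS2]
      ring
    · refine hg _ ![0, -2 * (X 0 * X 0), 2 * (X 0 * (X 1 - X 0)), X 1 - X 0, 0, 0]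
        ![0, 0, 0, 0, 0, 1, 0] ?_ rfl rfl
      simp [mulRel₀, map_ofNat]
      ring
    · refine hg _ ![0, -2 * (X 1 * X 0), 2 * (X 1 * (X 1 - X 0)), 0, X 1 - X 0, 0]
        ![0, 0, 0, 1, 2, 1, 0] ?_ rfl rfl
      simp [mulRel₀, mulRel₁, mulQuadric, map_ofNat]
      ring
    · refine hg _ ![0, -2 * (X 2 * X 0), 2 * (X 2 * (X 1 - X 0)), 0, 0, X 1 - X 0]
        ![0, 0, 0, 1, 0, 0, 0] ?_ rfl rfl
      simp [mulRel₀, map_ofNat]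
      ring
    · refine hg _ ![0, 0, 1, 0, 0, 0] 0 ?_ rfl rfl
      simp
    · refine hg _ ![-(X 0 * X 2), X 0, X 0 - X 1, C 2⁻¹, -C 2⁻¹, C 2⁻¹] 0 ?_ rfl rfl
      rw [Fin.mk_one, Fin.mk_one, Matrix.cons_val_one, Matrix.cons_val_zero, mul_comm, hS2]
      simp
      ring
    · refine hg _ ![X 0 * X 2 + X 0 * X 1, -2 * X 0, -2 * X 0, -1, 0, 0] 0 ?_ rfl rfl
      simp [mulQuadric, map_ofNat]
      ring
    · refine hg _ ![-2 * (X 0 * (X 0 * X 1)), 2 * (X 0 * X 0), 2 * (X 0 * X 0), X 0, 0, 0]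
        ![0, 0, 0, 0, 0, 0, 1] ?_ rfl rfl
      simp [mulRel₁, map_ofNat]
      ring
    · refine hg _ ![-2 * (X 1 * (X 0 * X 1)), 2 * (X 1 * X 0), 2 * (X 1 * X 0), 0, X 0, 0]
        ![-4, 0, 0, 0, 1, 2, 1] ?_ rfl rfl
      simp [mulRel₀, mulRel₁, mulQuadric, map_ofNat]
      ring
    · refine hg _ ![-2 * (X 2 * (X 0 * X 1)), 2 * (X 2 * X 0), 2 * (X 2 * X 0), 0, 0, X 0]
        ![0, 0, 0, 0, 1, 0, 0] ?_ rfl rfl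
      simp [mulRel₁, map_ofNat]
      ring
  · intro P h
    simp only [Fin.sum_univ_six, Matrix.cons_val, map_one, aeval_X, squaresAnd_inr,
      aeval_mulQuadric] at h ⊢
    simp only [irreduciblePair, Matrix.cons_val] at h
    obtain ⟨h0, h1, h2, h3⟩ := eq_zero_of_even_sum (P₀ := P 0) (P₁ := P 1) (P₂ := P 2 - P 1)
      (P₃ := -P 2 + 2 * (X 0 * P 3 + X 1 * P 4 + X 2 * P 5))
      (by rw [← h]; simp [map_ofNat]; ring)
    have h2' : P 2 = 0 := by simpa [h1] using h2
    obtain ⟨u, v, w, h4, h5, h6⟩ := exists_koszul (p := P 3) (q := P 4) (s := P 5)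
      (by simpa [h2'] using h3)
    refine Ideal.mem_span_range_iff_exists_fun.2
      ⟨![-rename Sum.inl w, rename Sum.inl u, rename Sum.inl v, 0, 0, 0, 0], ?_⟩
    simp only [Fin.sum_univ_seven, irreduciblePairRel, Matrix.cons_val, h0, h1, h2', h4, h5, h6,
      map_sub, map_mul, map_add, map_neg, map_zero, rename_X]
    ring

/-! ### Homogeneity and linear independence of the relations -/

section Homogeneity

variable {σ : Type*}

theorem isHomogeneous_X_mul_X (i j : σ) : (X i * X j : MvPolynomial σ ℂ).IsHomogeneous 2 :=
  (isHomogeneous_X ℂ i).mul (isHomogeneous_X ℂ j)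

theorem isHomogeneous_ofNat_mul {f : MvPolynomial σ ℂ} {d : ℕ} (hf : f.IsHomogeneous d) (k : ℕ)
    [k.AtLeastTwo] : (OfNat.ofNat k * f).IsHomogeneous d := by
  rw [← map_ofNat C]
  exact hf.C_mul _

theorem isHomogeneous_X_mul {f : MvPolynomial σ ℂ} (i : σ) {d : ℕ} (hf : f.IsHomogeneous d) :
    (X i * f).IsHomogeneous (d + 1) := by
  rw [add_comm]
  exact (isHomogeneous_X ℂ i).mul hf

theorem oneProductRel_isHomogeneous (i : Fin 1) : (oneProductRel i).IsHomogeneous 2 :=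
  (isHomogeneous_X_pow _ 2).sub (isHomogeneous_X_mul_X _ _)

theorem threeProductsRel_isHomogeneous (i : Fin 6) : (threeProductsRel i).IsHomogeneous 2 := by
  fin_cases i
  iterate 3 exact (isHomogeneous_X_pow _ 2).sub (isHomogeneous_X_mul_X _ _)
  iterate 3 exact (isHomogeneous_X_mul_X _ _).sub (isHomogeneous_X_mul_X _ _)

theorem sumProductsRel_isHomogeneous (i : Fin 1) : (sumProductsRel i).IsHomogeneous 4 :=
  (((isHomogeneous_X_pow _ 2).sub (((isHomogeneous_X_mul_X _ _).add
    (isHomogeneous_X_mul_X _ _)).add (isHomogeneous_X_mul_X _ _))).pow 2).sub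
  (isHomogeneous_ofNat_mul (((isHomogeneous_X_mul_X _ _).mul (isHomogeneous_X ℂ _)).mul
    ((((isHomogeneous_X ℂ _).add (isHomogeneous_X ℂ _)).add (isHomogeneous_X ℂ _)).add
      (isHomogeneous_ofNat_mul (isHomogeneous_X ℂ _) 2))) 4)

theorem reduciblePairRel_isHomogeneous (α β : ℂ) (i : Fin 2) :
    (reduciblePairRel α β i).IsHomogeneous 2 := by
  fin_cases i
  · exact (isHomogeneous_X_pow _ 2).sub (isHomogeneous_X_mul_X _ _)
  · exact (isHomogeneous_X_pow _ 2).sub (isHomogeneous_X_mul _ (((isHomogeneous_C_mul_X _ _).add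
      (isHomogeneous_C_mul_X _ _)).sub (isHomogeneous_C_mul_X _ _)))

theorem mulQuadric_isHomogeneous (i : Fin 3) : (mulQuadric i).IsHomogeneous 2 := by
  have h2 := fun i j : Fin 3 ⊕ Fin 2 => isHomogeneous_ofNat_mul (isHomogeneous_X_mul_X i j) 2
  have h := fun i j : Fin 3 ⊕ Fin 2 => isHomogeneous_X_mul_X i j
  have hp := fun i : Fin 3 ⊕ Fin 2 => isHomogeneous_X_pow (R := ℂ) i 2
  fin_cases i
  · exact (((h _ _).add (h _ _)).sub (isHomogeneous_ofNat_mul (isHomogeneous_X_mul _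
      ((isHomogeneous_X ℂ _).add (isHomogeneous_X ℂ _))) 2)).sub (hp _)
  · exact (((((h _ _).add (h _ _)).sub (hp _)).sub (hp _)).sub (h2 _ _)).sub (h2 _ _)
  · exact ((h _ _).add (h _ _)).sub (hp _)

theorem mulRel₀_isHomogeneous (i : Fin 3) : (mulRel₀ i).IsHomogeneous 3 := by
  have hX := fun i : Fin 3 ⊕ Fin 2 => isHomogeneous_X ℂ i
  have h := fun i j : Fin 3 ⊕ Fin 2 => isHomogeneous_X_mul_X i j
  exact (isHomogeneous_X_mul _ (mulQuadric_isHomogeneous i)).sub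
    ((isHomogeneous_ofNat_mul (isHomogeneous_X_mul _ ((h _ _).sub
      (isHomogeneous_X_mul _ ((hX _).add (hX _))))) 2).add
      (((hX _).sub (hX _)).mul (mulQuadric_isHomogeneous i)))

theorem mulRel₁_isHomogeneous (i : Fin 3) : (mulRel₁ i).IsHomogeneous 3 := by
  have hX := fun i : Fin 3 ⊕ Fin 2 => isHomogeneous_X ℂ i
  have h := fun i j : Fin 3 ⊕ Fin 2 => isHomogeneous_X_mul_X i j
  exact (isHomogeneous_X_mul _ (mulQuadric_isHomogeneous i)).sub
    ((isHomogeneous_ofNat_mul (isHomogeneous_X_mul _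
      ((isHomogeneous_X_mul _ ((hX _).add (hX _))).sub (h _ _))) 2).add
      (isHomogeneous_X_mul _ (mulQuadric_isHomogeneous i)))

theorem irreduciblePairRel_isHomogeneous (i : Fin 7) :
    (irreduciblePairRel i).IsHomogeneous 3 := by
  have h := fun (j : Fin 3 ⊕ Fin 2) (i : Fin 3) =>
    isHomogeneous_X_mul j (mulQuadric_isHomogeneous i)
  fin_cases i
  iterate 3 exact (h _ _).sub (h _ _)
  · exact mulRel₀_isHomogeneous 2
  · exact mulRel₁_isHomogeneous 2
  · exact mulRel₀_isHomogeneous 0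
  · exact mulRel₁_isHomogeneous 0

end Homogeneity

theorem eval_sum_smul {σ κ : Type*} [Fintype κ] {g : κ → MvPolynomial σ ℂ} {c : κ → ℂ}
    (h : ∑ i, c i • g i = 0) (v : σ → ℂ) : ∑ i, c i * eval v (g i) = 0 := by
  simpa [smul_eval] using congrArg (eval v) h

theorem linearIndependent_of_eval {σ : Type*} {g : Fin 1 → MvPolynomial σ ℂ} (v : σ → ℂ)
    (h : eval v (g 0) ≠ 0) : LinearIndependent ℂ g := by
  rw [Fintype.linearIndependent_iff]
  intro c hc i
  have := eval_sum_smul hc v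
  fin_cases i
  simpa [h] using this

theorem linearIndependent_oneProductRel : LinearIndependent ℂ oneProductRel :=
  linearIndependent_of_eval (Sum.elim 0 ![1]) (by simp [oneProductRel])

theorem linearIndependent_sumProductsRel : LinearIndependent ℂ sumProductsRel :=
  linearIndependent_of_eval (Sum.elim 0 ![1]) (by simp [sumProductsRel])

theorem linearIndependent_reduciblePairRel (α β : ℂ) :
    LinearIndependent ℂ (reduciblePairRel α β) := by
  rw [Fintype.linearIndependent_iff]
  intro c hc
  have e0 := eval_sum_smul hc (Sum.elim 0 ![1, 0])
  have e1 := eval_sum_smul hc (Sum.elim 0 ![0, 1])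
  simp [reduciblePairRel] at e0 e1
  rw [Fin.forall_fin_two]
  exact ⟨e0, e1⟩

theorem linearIndependent_threeProductsRel : LinearIndependent ℂ threeProductsRel := by
  rw [Fintype.linearIndependent_iff]
  intro c hc
  have e0 := eval_sum_smul hc (Sum.elim 0 ![1, 0, 0])
  have e1 := eval_sum_smul hc (Sum.elim 0 ![0, 1, 0])
  have e2 := eval_sum_smul hc (Sum.elim 0 ![0, 0, 1])
  have e3 := eval_sum_smul hc (Sum.elim 0 ![1, 1, 0])
  have e4 := eval_sum_smul hc (Sum.elim 0 ![1, 0, 1])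
  have e5 := eval_sum_smul hc (Sum.elim 0 ![0, 1, 1])
  simp [Fin.sum_univ_six, threeProductsRel] at e0 e1 e2 e3 e4 e5
  simp only [e0, e1, e2, zero_add, add_zero] at e3 e4 e5
  intro i
  fin_cases i <;> assumption

theorem linearIndependent_irreduciblePairRel : LinearIndependent ℂ irreduciblePairRel := by
  rw [Fintype.linearIndependent_iff]
  intro c hc
  have hv := fun v w => eval_sum_smul hc (Sum.elim v w)
  simp only [Fin.sum_univ_seven, irreduciblePairRel, mulRel₀, mulRel₁, mulQuadric,
    Matrix.cons_val, map_add, map_sub, map_mul, map_pow, eval_X, map_ofNat, Sum.elim_inl,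
    Sum.elim_inr] at hv
  have e3 := hv ![0, 0, 0] ![1, 0]
  have e6 := hv ![0, 0, 0] ![0, 1]
  have e4 := hv ![0, 0, 0] ![1, 1]
  have e5 := hv ![0, 0, 0] ![1, -1]
  have f0 := hv ![1, 0, 0] ![0, 1]
  have f1 := hv ![1, 0, 0] ![1, 0]
  have f2 := hv ![0, 1, 0] ![1, 0]
  simp only [Matrix.cons_val] at e3 e4 e5 e6 f0 f1 f2
  have h3 : c 3 = 0 := by linear_combination -e3
  have h6 : c 6 = 0 := by linear_combination -e6
  have h4 : c 4 = 0 := by linear_combination -(1 / 2) * (e4 - e5) - h6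
  have h5 : c 5 = 0 := by linear_combination -(1 / 2) * (e4 + e5) - h3
  have h0 : c 0 = 0 := by
    simp only [h3, h4, h5, h6] at f0
    linear_combination -f0
  have h1 : c 1 = 0 := by
    simp only [h0, h3, h4, h5, h6] at f1
    linear_combination -f1
  have h2 : c 2 = 0 := by
    simp only [h0, h1, h3, h4, h5, h6] at f2
    linear_combination -f2
  intro i
  fin_cases i <;> assumption

/-! ### Height in the reducible case -/

instance isPrime_ker_linSubst {m κ : Type*} [Fintype m] [Fintype κ] [DecidableEq m]
    (T : (m → ℂ) →ₗ[ℂ] (κ → ℂ)) : (RingHom.ker (linSubst T)).IsPrime :=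
  RingHom.ker_isPrime _

/-- The ideal generated by the linear forms that a linear substitution kills has height at least
the dimension of the space of these forms: imposing one more condition at a time gives a descending
chain of prime ideals of the same kind. -/
theorem le_height_ker_linSubst {m : Type} [Fintype m] [DecidableEq m] (d : ℕ) :
    ∀ {κ : Type} [Fintype κ] (T : (m → ℂ) →ₗ[ℂ] (κ → ℂ)),
      d ≤ Module.finrank ℂ (LinearMap.ker T) → (d : ℕ∞) ≤ (RingHom.ker (linSubst T)).height := by
  classical
  induction d with
  | zero => intros; simp
  | succ d ih =>
    intro κ _ T hT
    obtain ⟨v, hv⟩ := (Module.finrank_pos_iff_exists_ne_zero (R := ℂ)).1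
      (show 0 < Module.finrank ℂ (LinearMap.ker T) by omega)
    obtain ⟨φ, hφ⟩ := Module.Projective.exists_dual_ne_zero ℂ (x := v.1) (by simpa using hv)
    let T' : (m → ℂ) →ₗ[ℂ] (κ ⊕ Unit → ℂ) :=
      LinearMap.pi (Sum.elim (fun k => LinearMap.proj k ∘ₗ T) fun _ => φ)
    let R : (κ ⊕ Unit → ℂ) →ₗ[ℂ] (κ → ℂ) := LinearMap.funLeft ℂ ℂ Sum.inl
    have hR : ∀ f, linSubst R (linSubst T' f) = linSubst T f := by
      intro f
      have : (linSubst R).comp (linSubst T') = linSubst T := by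
        ext1 i
        rw [AlgHom.comp_apply, linSubst_X, linSubst_linForm, linSubst_X]
        rfl
      exact DFunLike.congr_fun this f
    have hker : LinearMap.ker T ⊓ LinearMap.ker φ ≤ LinearMap.ker T' := by
      rintro w ⟨hw, hw'⟩
      rw [LinearMap.mem_ker]
      ext (k | k)
      · exact congrFun hw k
      · exact hw'
    have hdim : d ≤ Module.finrank ℂ (LinearMap.ker T') := by
      have h1 := Submodule.finrank_mono hker
      have h2 := Submodule.finrank_sup_add_finrank_inf_eq (LinearMap.ker T) (LinearMap.ker φ)
      have h3 := φ.finrank_range_add_finrank_ker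
      have h4 := Submodule.finrank_le (LinearMap.range φ)
      have h5 := Submodule.finrank_le (LinearMap.ker T ⊔ LinearMap.ker φ)
      rw [Module.finrank_self] at h4
      omega
    have hlt : RingHom.ker (linSubst T') < RingHom.ker (linSubst T) := by
      refine lt_of_le_of_ne (fun f hf => ?_) fun h => ?_
      · rw [RingHom.mem_ker, ← hR, RingHom.mem_ker.1 hf, map_zero]
      · have hmem : linForm m v.1 ∈ RingHom.ker (linSubst T) := by
          rw [RingHom.mem_ker, linSubst_linForm, v.2, map_zero]
        rw [← h, RingHom.mem_ker, linSubst_linForm] at hmem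
        have := linForm_injective (hmem.trans (map_zero _).symm)
        exact hφ (congrFun this (Sum.inr ()))
    calc ((d + 1 : ℕ) : ℕ∞) = d + 1 := by push_cast; rfl
      _ ≤ (RingHom.ker (linSubst T')).height + 1 := by gcongr; exact ih T' hdim
      _ ≤ _ := Ideal.height_add_one_le_of_lt_of_isPrime hlt

/-- The first relation of a reducible pair alone defines a prime ideal strictly between zero and the
ideal of all relations. -/
theorem exists_isPrime_between (α β : ℂ) : ∃ K : Ideal (MvPolynomial (Fin 3 ⊕ Fin 2) ℂ),
    K.IsPrime ∧ ⊥ < K ∧ K < RingHom.ker (aeval (squaresAnd (reduciblePair α β))) := by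
  -- make the second quadric of the pair a free variable
  let ρ : MvPolynomial (Fin 3 ⊕ Fin 2) ℂ →ₐ[ℂ] Polynomial (MvPolynomial (Fin 3) ℂ) :=
    aeval (Sum.elim (fun j => Polynomial.C (X j ^ 2)) ![Polynomial.C (X 0 * X 1), Polynomial.X])
  have hρ : ∀ f, Polynomial.eval (reduciblePair α β 1) (ρ f) =
      aeval (squaresAnd (reduciblePair α β)) f := by
    intro f
    have : ((Polynomial.aeval (reduciblePair α β 1)).restrictScalars ℂ).comp ρ =
        aeval (squaresAnd (reduciblePair α β)) := by
      ext1 i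
      rcases i with i | i
      · simp [ρ]
      · fin_cases i <;> simp [ρ, reduciblePair]
    exact DFunLike.congr_fun this f
  refine ⟨RingHom.ker ρ, RingHom.ker_isPrime _, ?_, ?_⟩
  · rw [bot_lt_iff_ne_bot]
    intro h
    have hmem : reduciblePairRel α β 0 ∈ RingHom.ker ρ := by
      rw [RingHom.mem_ker]
      simp [ρ, reduciblePairRel]
      ring
    rw [h, Ideal.mem_bot] at hmem
    exact (linearIndependent_reduciblePairRel α β).ne_zero 0 hmem
  · refine lt_of_le_of_ne (fun f hf => ?_) fun h => ?_
    · rw [RingHom.mem_ker, ← hρ, RingHom.mem_ker.1 hf, Polynomial.eval_zero]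
    · have hmem : reduciblePairRel α β 1 ∈
          RingHom.ker (aeval (squaresAnd (reduciblePair α β))) := by
        rw [RingHom.mem_ker]
        simp [reduciblePairRel, reduciblePair, map_ofNat]
        ring
      rw [← h, RingHom.mem_ker] at hmem
      have h2 := congrArg (fun p => Polynomial.coeff p 2) hmem
      have hC : ∀ z : ℂ, ρ (C z) = Polynomial.C (C z) := fun z => by
        rw [← algebraMap_eq, AlgHom.commutes]; rfl
      simp only [reduciblePairRel, Matrix.cons_val, map_sub, map_add, map_mul, map_pow ρ, hC] at h2
      simp [ρ, ← Polynomial.C_mul, ← Polynomial.C_add, ← Polynomial.C_sub, -map_mul,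
        -map_pow, -map_add, -map_sub] at h2

/-- If the `S i` span the same space as `y₀², y₁², y₂²` and a reducible pair, then the ideal of
relations between them is a complete intersection. -/
theorem isCompleteIntersection_ker_aeval {n : ℕ} {S : Fin (n + 1) → MvPolynomial (Fin 3) ℂ}
    {α β : ℂ} (h0 : α ≠ 0 ∨ β ≠ 0)
    (hspan : Submodule.span ℂ (Set.range S) =
      Submodule.span ℂ (Set.range (squaresAnd (reduciblePair α β)))) :
    4 ≤ n ∧ IsCompleteIntersection
      (RingHom.ker (aeval S : CoordRing n →ₐ[ℂ] MvPolynomial (Fin 3) ℂ)) (n - 4) 2 2 := by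
  obtain ⟨hn, hgen⟩ := minimallyGenerated_ker_aeval hspan le_rfl
    (reduciblePairRel_isHomogeneous α β) (ker_reduciblePair h0)
    (linearIndependent_reduciblePairRel α β)
  simp only [Fintype.card_sum, Fintype.card_fin] at hn hgen
  have e : n + 1 - (3 + 2) = n - 4 := by omega
  rw [e] at hgen
  refine ⟨by omega, hgen, le_antisymm ?_ ?_⟩
  · obtain ⟨f, hf⟩ := hgen
    refine (Ideal.height_le_spanFinrank _ (RingHom.ker_ne_top _)).trans ?_
    rw [← hf.span_eq]
    norm_cast
    refine (Submodule.spanFinrank_span_le_ncard_of_finite (Set.finite_range f)).trans ?_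
    rw [← Set.image_univ]
    refine (Set.ncard_image_le Set.finite_univ).trans ?_
    simp [Set.ncard_univ]
  · obtain ⟨M, N, hMN, hM⟩ := exists_coefficient_maps hspan
      (linearCombination_injective_of_ker le_rfl (reduciblePairRel_isHomogeneous α β)
        (ker_reduciblePair h0))
    obtain ⟨K, hK, hK0, hK1⟩ := exists_isPrime_between α β
    have hsurj : Function.Surjective (linSubst M) := fun f => ⟨linSubst N f, linSubst_comp hMN f⟩
    have hlt : ∀ {p q : Ideal (MvPolynomial (Fin 3 ⊕ Fin 2) ℂ)}, p < q →
        Ideal.comap (linSubst M) p < Ideal.comap (linSubst M) q := fun h =>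
      lt_of_le_of_ne (Ideal.comap_mono h.le)
        fun e => h.ne (Ideal.comap_injective_of_surjective (linSubst M) hsurj e)
    have hrank := M.finrank_range_add_finrank_ker
    rw [LinearMap.range_eq_top.2 (fun c => ⟨N c, LinearMap.congr_fun hMN c⟩), finrank_top,
      Module.finrank_fintype_fun_eq_card, Module.finrank_fintype_fun_eq_card] at hrank
    simp only [Fintype.card_sum, Fintype.card_fin] at hrank
    have h1 := le_height_ker_linSubst (n - 4) M (by omega)
    have hS : RingHom.ker (aeval S : CoordRing n →ₐ[ℂ] MvPolynomial (Fin 3) ℂ) =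
        Ideal.comap (linSubst M) (RingHom.ker (aeval (squaresAnd (reduciblePair α β)))) := by
      ext f
      rw [Ideal.mem_comap, RingHom.mem_ker, RingHom.mem_ker, aeval_linSubst hM]
    have hp0 : (Ideal.comap (linSubst M) ⊥).IsPrime := Ideal.comap_isPrime _ _
    have hp1 : (Ideal.comap (linSubst M) K).IsPrime := Ideal.comap_isPrime _ _
    have hp2 : (Ideal.comap (linSubst M)
      (RingHom.ker (aeval (squaresAnd (reduciblePair α β))))).IsPrime := by
      have := RingHom.ker_isPrime (aeval (R := ℂ) (squaresAnd (reduciblePair α β)))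
      exact Ideal.comap_isPrime _ _
    rw [hS]
    calc ((n - 4 + 2 : ℕ) : ℕ∞) = (n - 4 : ℕ) + 1 + 1 := by push_cast; rw [add_assoc]; rfl
      _ ≤ (Ideal.comap (linSubst M) ⊥).height + 1 + 1 := by gcongr; exact h1
      _ ≤ (Ideal.comap (linSubst M) K).height + 1 := by
        gcongr; exact Ideal.height_add_one_le_of_lt_of_isPrime (hlt hK0)
      _ ≤ _ := Ideal.height_add_one_le_of_lt_of_isPrime (hlt hK1)

/-! ### The span of squares of linear forms -/

/-- The values at a vector of `ℂ³` of the three products of two different coordinates. -/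
def mixed (x : Fin 3 → ℂ) : Fin 3 → ℂ := ![x 1 * x 2, x 0 * x 2, x 0 * x 1]

theorem linForm_sq (x : Fin 3 → ℂ) : linForm (Fin 3) x ^ 2 =
    ∑ j, x j ^ 2 • (X j : MvPolynomial (Fin 3) ℂ) ^ 2 +
      (2 : ℂ) • Fintype.linearCombination ℂ threeProducts (mixed x) := by
  simp [Fintype.linearCombination_apply, Fin.sum_univ_three, mixed, threeProducts,
    smul_eq_C_mul, map_ofNat]
  ring

/-- If multiples of the three coordinate forms occur among linear forms, then the squares of the
linear forms span the squares of the coordinates together with the mixed parts. -/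
theorem span_sq_eq_span_squaresAnd {m : Type*} {A : m → Fin 3 → ℂ}
    (hA : ∀ j, ∃ i, ∃ c : ℂ, c ≠ 0 ∧ A i = Pi.single j c) {r : ℕ} {N : Fin r → Fin 3 → ℂ}
    (hN : Submodule.span ℂ (Set.range fun i => mixed (A i)) = Submodule.span ℂ (Set.range N)) :
    Submodule.span ℂ (Set.range fun i => linForm (Fin 3) (A i) ^ 2) =
      Submodule.span ℂ (Set.range
        (squaresAnd fun k => Fintype.linearCombination ℂ threeProducts (N k))) := by
  apply le_antisymm
  · rw [Submodule.span_le]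
    rintro _ ⟨i, rfl⟩
    simp only [SetLike.mem_coe, linForm_sq]
    refine add_mem (sum_mem fun j _ =>
        Submodule.smul_mem _ _ (Submodule.subset_span ⟨Sum.inl j, rfl⟩))
      (Submodule.smul_mem _ _ ?_)
    have h : mixed (A i) ∈ Submodule.span ℂ (Set.range N) := hN ▸ Submodule.subset_span ⟨i, rfl⟩
    have := Submodule.mem_map_of_mem (f := Fintype.linearCombination ℂ threeProducts) h
    rw [Submodule.map_span, ← Set.range_comp] at this
    refine Submodule.span_mono ?_ this
    rintro _ ⟨k, rfl⟩
    exact ⟨Sum.inr k, rfl⟩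
  · have hsq : ∀ j, (X j : MvPolynomial (Fin 3) ℂ) ^ 2 ∈
        Submodule.span ℂ (Set.range fun i => linForm (Fin 3) (A i) ^ 2) := by
      intro j
      obtain ⟨i, c, hc, hi⟩ := hA j
      have : (X j : MvPolynomial (Fin 3) ℂ) ^ 2 = (c ^ 2)⁻¹ • linForm (Fin 3) (A i) ^ 2 := by
        rw [hi, show Pi.single j c = c • (Pi.single j 1 : Fin 3 → ℂ) by simp [← Pi.single_smul],
          map_smul, linForm_single, smul_pow, smul_smul,
          inv_mul_cancel₀ (pow_ne_zero 2 hc), one_smul]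
      rw [this]
      exact Submodule.smul_mem _ _ (Submodule.subset_span ⟨i, rfl⟩)
    have hmix : ∀ i, Fintype.linearCombination ℂ threeProducts (mixed (A i)) ∈
        Submodule.span ℂ (Set.range fun i => linForm (Fin 3) (A i) ^ 2) := by
      intro i
      have h2 : Fintype.linearCombination ℂ threeProducts (mixed (A i)) =
          (2 : ℂ)⁻¹ • (linForm (Fin 3) (A i) ^ 2 -
            ∑ j, A i j ^ 2 • (X j : MvPolynomial (Fin 3) ℂ) ^ 2) := by
        rw [linForm_sq, add_sub_cancel_left, smul_smul, inv_mul_cancel₀ two_ne_zero, one_smul]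
      rw [h2]
      exact Submodule.smul_mem _ _ (sub_mem (Submodule.subset_span ⟨i, rfl⟩)
        (sum_mem fun j _ => Submodule.smul_mem _ _ (hsq j)))
    rw [Submodule.span_le]
    rintro _ ⟨j | k, rfl⟩
    · exact hsq j
    · have h : N k ∈ Submodule.span ℂ (Set.range fun i => mixed (A i)) :=
        hN ▸ Submodule.subset_span ⟨k, rfl⟩
      have := Submodule.mem_map_of_mem (f := Fintype.linearCombination ℂ threeProducts) h
      rw [Submodule.map_span, ← Set.range_comp] at this
      refine Submodule.span_le.2 ?_ this
      rintro _ ⟨i, rfl⟩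
      exact hmix i

/-- A subspace of `ℂ³` is determined by the linear forms that vanish on it. -/
theorem span_le_span_of_dotProduct {m m' : Type*} {F : m → Fin 3 → ℂ} {G : m' → Fin 3 → ℂ}
    (h : ∀ γ : Fin 3 → ℂ, (∀ k, γ ⬝ᵥ G k = 0) → ∀ i, γ ⬝ᵥ F i = 0) :
    Submodule.span ℂ (Set.range F) ≤ Submodule.span ℂ (Set.range G) := by
  rw [Submodule.span_le]
  rintro _ ⟨i, rfl⟩
  by_contra hi
  obtain ⟨f, hf, hle⟩ := Submodule.exists_le_ker_of_notMem hi
  have hdot : ∀ x, (fun j => f (Pi.single j 1)) ⬝ᵥ x = f x := by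
    intro x
    rw [dotProduct_comm]
    exact linearCombination_comp_single f x
  refine hf ?_
  rw [← hdot]
  refine h _ (fun k => ?_) i
  rw [hdot]
  exact hle (Submodule.subset_span ⟨k, rfl⟩)

theorem span_eq_span_of_dotProduct {m m' : Type*} {F : m → Fin 3 → ℂ} {G : m' → Fin 3 → ℂ}
    (h : ∀ γ : Fin 3 → ℂ, (∀ i, γ ⬝ᵥ F i = 0) ↔ ∀ k, γ ⬝ᵥ G k = 0) :
    Submodule.span ℂ (Set.range F) = Submodule.span ℂ (Set.range G) :=
  le_antisymm (span_le_span_of_dotProduct fun γ => (h γ).2)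
    (span_le_span_of_dotProduct fun γ => (h γ).1)

/-! ### The defining ideal as an ideal of relations -/

section Ideal

variable {W : Type*} [AddCommGroup W] [Module ℂ W] {n : ℕ}

/-- The squares of the coordinate forms of `ι`, as polynomials in the coordinates belonging to a
basis of the dual space. -/
noncomputable def coordSquares (b : Module.Basis (Fin 3) ℂ (Module.Dual ℂ W))
    (ι : W →ₗ[ℂ] (Fin (n + 1) → ℂ)) (i : Fin (n + 1)) : MvPolynomial (Fin 3) ℂ :=
  linForm (Fin 3) (b.equivFun (coordForm ι i)) ^ 2

theorem eval_aeval_coordSquares (b : Module.Basis (Fin 3) ℂ (Module.Dual ℂ W))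
    (ι : W →ₗ[ℂ] (Fin (n + 1) → ℂ)) (f : CoordRing n) (w : W) :
    eval (fun j => b j w) (aeval (coordSquares b ι) f) = eval (fun i => ι w i ^ 2) f := by
  have : ((aeval fun j => b j w).comp (aeval (coordSquares b ι)) : CoordRing n →ₐ[ℂ] ℂ) =
      aeval fun i => ι w i ^ 2 := by
    ext1 i
    have h := congrArg (fun l : Module.Dual ℂ W => l w) (b.sum_equivFun (coordForm ι i))
    simp only [LinearMap.sum_apply, LinearMap.smul_apply] at h
    rw [AlgHom.comp_apply, aeval_X, aeval_X, coordSquares, map_pow, aeval_linForm,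
      Fintype.linearCombination_apply, h]
    rfl
  exact DFunLike.congr_fun this f

/-- The defining ideal of the coordinate-wise square of a plane consists of the polynomial
relations between the squares of the coordinate forms. -/
theorem definingIdeal_coordPower_eq_ker [FiniteDimensional ℂ W]
    (b : Module.Basis (Fin 3) ℂ (Module.Dual ℂ W))
    (ι : W →ₗ[ℂ] (Fin (n + 1) → ℂ)) (hι : Function.Injective ι) :
    definingIdeal (coordPower (linearSpace ι hι) 2) =
      RingHom.ker (aeval (coordSquares b ι) : CoordRing n →ₐ[ℂ] MvPolynomial (Fin 3) ℂ) := by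
  have hne : ∀ w : W, w ≠ 0 → (fun i => ι w i ^ 2) ≠ 0 := by
    intro w hw h
    refine hw (hι ?_)
    rw [map_zero]
    ext i
    exact (pow_eq_zero_iff two_ne_zero).1 (congrFun h i)
  have hpow : ∀ (w : W) (hw : w ≠ 0), powMap n 2 (Projectivization.map ι hι (.mk ℂ w hw)) =
      Projectivization.mk ℂ (fun i => ι w i ^ 2) (hne w hw) := fun w hw => rfl
  ext f
  constructor
  · intro hf
    rw [RingHom.mem_ker]
    -- multiplication by a variable takes care of the origin
    refine (mul_eq_zero.1 (?_ : X 0 * aeval (coordSquares b ι) f = 0)).resolve_left (X_ne_zero 0)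
    refine MvPolynomial.funext fun y => ?_
    obtain ⟨w, hw⟩ := (Module.evalEquiv ℂ W).surjective (b.constr ℂ y)
    have hy : y = fun j => b j w := by
      ext j
      have := congrArg (fun F => F (b j)) hw
      simpa [Module.Basis.constr_basis] using this.symm
    rw [map_mul, hy, eval_aeval_coordSquares, map_zero]
    by_cases hw0 : w = 0
    · simp [hw0]
    · rw [hf _ (hne w hw0) ⟨_, ⟨.mk ℂ w hw0, rfl⟩, hpow w hw0⟩, mul_zero]
  · rintro hf v hv ⟨_, ⟨p, rfl⟩, hp⟩
    induction p using Projectivization.ind with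
    | h w hw =>
      rw [hpow] at hp
      obtain ⟨t, ht⟩ := (Projectivization.mk_eq_mk_iff' ℂ _ _ _ _).1 hp.symm
      obtain ⟨s, rfl⟩ := IsAlgClosed.exists_pow_nat_eq t two_pos
      have hv' : v = fun i => ι (s • w) i ^ 2 := by
        rw [← ht]
        ext i
        simp [mul_pow]
      rw [hv', ← eval_aeval_coordSquares b, RingHom.mem_ker.1 hf, map_zero]

end Ideal

/-! ### Bases consisting of points of the configuration -/

section Geometry

variable {W : Type*} [AddCommGroup W] [Module ℂ W] {n : ℕ}
  {b : Module.Basis (Fin 3) ℂ (Module.Dual ℂ W)} {ι : W →ₗ[ℂ] (Fin (n + 1) → ℂ)}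

/-- The members of the basis `b` represent points of the configuration of `ι`. -/
def IsConfigBasis (b : Module.Basis (Fin 3) ℂ (Module.Dual ℂ W))
    (ι : W →ₗ[ℂ] (Fin (n + 1) → ℂ)) : Prop :=
  ∀ j, ∃ i, ∃ c : ℂ, c ≠ 0 ∧ coordForm ι i = c • b j

theorem exists_isConfigBasis [FiniteDimensional ℂ W] (hW : Module.finrank ℂ W = 3)
    (hι : Function.Injective ι) :
    ∃ b : Module.Basis (Fin 3) ℂ (Module.Dual ℂ W), IsConfigBasis b ι := by
  have hspan : Submodule.span ℂ (Set.range (coordForm ι)) = ⊤ := by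
    by_contra h
    obtain ⟨F, hF, hle⟩ := Submodule.exists_le_ker_of_lt_top _ (lt_top_iff_ne_top.2 h)
    obtain ⟨w, rfl⟩ := (Module.evalEquiv ℂ W).surjective F
    refine hF ?_
    have : w = 0 := by
      refine hι ?_
      rw [map_zero]
      ext i
      exact hle (Submodule.subset_span ⟨i, rfl⟩)
    rw [this, map_zero]
  obtain ⟨κ, a, ha, hs, hli⟩ := exists_linearIndependent' ℂ (coordForm ι)
  rw [hspan] at hs
  let B := Module.Basis.mk hli hs.ge
  have : Fintype κ := FiniteDimensional.fintypeBasisIndex B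
  have hcard : Fintype.card κ = 3 := by
    rw [← Module.finrank_eq_card_basis B, Subspace.dual_finrank_eq, hW]
  refine ⟨B.reindex (Fintype.equivFinOfCardEq hcard), fun j =>
    ⟨a ((Fintype.equivFinOfCardEq hcard).symm j), 1, one_ne_zero, ?_⟩⟩
  simp [B]

theorem IsConfigBasis.isUnitSMul (hb : IsConfigBasis b ι) {w : Fin 3 → ℂ}
    (hw : ∀ j, IsUnit (w j)) : IsConfigBasis (b.isUnitSMul hw) ι := by
  intro j
  obtain ⟨i, c, hc, hi⟩ := hb j
  refine ⟨i, c * (w j)⁻¹, mul_ne_zero hc (inv_ne_zero (hw j).ne_zero), ?_⟩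
  rw [Module.Basis.isUnitSMul_apply, smul_smul, mul_assoc,
    inv_mul_cancel₀ (hw j).ne_zero, mul_one, hi]

theorem IsConfigBasis.reindex (hb : IsConfigBasis b ι) (e : Equiv.Perm (Fin 3)) :
    IsConfigBasis (b.reindex e) ι := by
  intro j
  rw [Module.Basis.reindex_apply]
  exact hb _

/-- The span of the squares of the coordinate forms is determined by the conics through the
configuration: if these are the forms that vanish on the `N k`, then it is spanned by the squares of
the basis and the mixed quadrics with coefficients `N k`. -/
theorem IsConfigBasis.span_coordSquares (hb : IsConfigBasis b ι) {r : ℕ} {N : Fin r → Fin 3 → ℂ}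
    (hN : ∀ γ : Fin 3 → ℂ, (∀ i, γ ⬝ᵥ mixed (b.equivFun (coordForm ι i)) = 0) ↔
      ∀ k, γ ⬝ᵥ N k = 0) {m : Fin r → MvPolynomial (Fin 3) ℂ}
    (hm : ∀ k, m k = Fintype.linearCombination ℂ threeProducts (N k)) :
    Submodule.span ℂ (Set.range (coordSquares b ι)) =
      Submodule.span ℂ (Set.range (squaresAnd m)) := by
  rw [show m = _ from funext hm]
  refine span_sq_eq_span_squaresAnd (fun j => ?_) (span_eq_span_of_dotProduct hN)
  obtain ⟨i, c, hc, hi⟩ := hb j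
  refine ⟨i, c, hc, ?_⟩
  rw [hi, map_smul]
  ext k
  simp [Finsupp.single_apply, Pi.single_apply, eq_comm]

theorem IsConfigBasis.minimallyGenerated [FiniteDimensional ℂ W] (hb : IsConfigBasis b ι)
    (hι : Function.Injective ι) {r : ℕ} {N : Fin r → Fin 3 → ℂ}
    (hN : ∀ γ : Fin 3 → ℂ, (∀ i, γ ⬝ᵥ mixed (b.equivFun (coordForm ι i)) = 0) ↔
      ∀ k, γ ⬝ᵥ N k = 0) {m : Fin r → MvPolynomial (Fin 3) ℂ}
    (hm : ∀ k, m k = Fintype.linearCombination ℂ threeProducts (N k))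
    {c d : ℕ} (hd : 2 ≤ d) {g : Fin c → MvPolynomial (Fin 3 ⊕ Fin r) ℂ}
    (hg : ∀ i, (g i).IsHomogeneous d)
    (hker : RingHom.ker (aeval (squaresAnd m)) = Ideal.span (Set.range g))
    (hli : LinearIndependent ℂ g) :
    r + 2 ≤ n ∧
      MinimallyGenerated (definingIdeal (coordPower (linearSpace ι hι) 2)) (n - (r + 2)) c d := by
  obtain ⟨h1, h2⟩ := minimallyGenerated_ker_aeval (hb.span_coordSquares hN hm) hd hg hker hli
  simp only [Fintype.card_sum, Fintype.card_fin] at h1 h2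
  rw [definingIdeal_coordPower_eq_ker b]
  refine ⟨by omega, ?_⟩
  rwa [show n - (r + 2) = n + 1 - (3 + r) by omega]

/-! ### Conics -/

/-- The quadratic form without square terms, relative to a basis, that has given coefficients. -/
noncomputable def conicForm (b : Module.Basis (Fin 3) ℂ (Module.Dual ℂ W)) (γ : Fin 3 → ℂ) :
    QuadraticForm ℂ (Module.Dual ℂ W) :=
  γ 0 • QuadraticMap.linMulLin (b.coord 1) (b.coord 2) +
    γ 1 • QuadraticMap.linMulLin (b.coord 0) (b.coord 2) +
    γ 2 • QuadraticMap.linMulLin (b.coord 0) (b.coord 1)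

theorem conicForm_apply (γ : Fin 3 → ℂ) (v : Module.Dual ℂ W) :
    conicForm b γ v = γ ⬝ᵥ mixed (b.equivFun v) := by
  simp [conicForm, mixed, dotProduct, Fin.sum_univ_three]

theorem conicForm_basis (γ : Fin 3 → ℂ) (s t : ℂ) :
    conicForm b γ (s • b 1 + t • b 2) = s * t * γ 0 ∧
      conicForm b γ (s • b 0 + t • b 2) = s * t * γ 1 ∧
      conicForm b γ (s • b 0 + t • b 1) = s * t * γ 2 := by
  simp [conicForm_apply, mixed, dotProduct, Fin.sum_univ_three]
  refine ⟨?_, ?_, ?_⟩ <;> ring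

theorem conicForm_smul (c : ℂ) (γ : Fin 3 → ℂ) : conicForm b (c • γ) = c • conicForm b γ := by
  ext v
  simp [conicForm_apply]

theorem conicForm_injective : Function.Injective (conicForm b) := by
  intro γ γ' h
  have h' : ∀ j k, γ ⬝ᵥ mixed (b.equivFun (b j + b k)) = γ' ⬝ᵥ mixed (b.equivFun (b j + b k)) :=
    fun j k => by rw [← conicForm_apply, ← conicForm_apply, h]
  have h0 := h' 1 2
  have h1 := h' 0 2
  have h2 := h' 0 1
  simp [mixed, dotProduct, Fin.sum_univ_three] at h0 h1 h2
  ext j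
  fin_cases j <;> assumption

theorem eq_conicForm {q : QuadraticForm ℂ (Module.Dual ℂ W)} (hq : ∀ j, q (b j) = 0) :
    ∃ γ, q = conicForm b γ := by
  refine ⟨![QuadraticMap.polar q (b 1) (b 2), QuadraticMap.polar q (b 0) (b 2),
    QuadraticMap.polar q (b 0) (b 1)], ?_⟩
  ext v
  rw [conicForm_apply]
  conv_lhs => rw [← b.sum_equivFun v]
  rw [Fin.sum_univ_three, QuadraticMap.map_add q, QuadraticMap.map_add q]
  simp only [QuadraticMap.map_smul, hq, QuadraticMap.polar_add_left, QuadraticMap.polar_smul_left,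
    QuadraticMap.polar_smul_right, smul_eq_mul, mixed, dotProduct, Fin.sum_univ_three,
    Matrix.cons_val]
  ring

theorem pointConfig_subset_conicOf {q : QuadraticForm ℂ (Module.Dual ℂ W)} :
    pointConfig ι ⊆ conicOf q ↔ ∀ i, q (coordForm ι i) = 0 := by
  have hmk : ∀ v (hv : v ≠ 0), Projectivization.mk ℂ v hv ∈ conicOf q ↔ q v = 0 := by
    intro v hv
    obtain ⟨a, ha⟩ := Projectivization.exists_smul_eq_mk_rep ℂ v hv
    change q (Projectivization.mk ℂ v hv).rep = 0 ↔ _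
    rw [← ha, Units.smul_def, QuadraticMap.map_smul]
    simp
  constructor
  · intro h i
    by_cases hi : coordForm ι i = 0
    · rw [hi, QuadraticMap.map_zero]
    · exact (hmk _ hi).1 (h ⟨i, hi, rfl⟩)
  · rintro h _ ⟨i, hi, rfl⟩
    exact (hmk _ hi).2 (h i)

theorem IsConfigBasis.liesOnConic_iff (hb : IsConfigBasis b ι)
    {q : QuadraticForm ℂ (Module.Dual ℂ W)} : LiesOnConic (pointConfig ι) q ↔
      ∃ γ, γ ≠ 0 ∧ q = conicForm b γ ∧ ∀ i, γ ⬝ᵥ mixed (b.equivFun (coordForm ι i)) = 0 := by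
  have h0 : conicForm b 0 = 0 := by simpa using conicForm_smul (b := b) 0 0
  rw [LiesOnConic, pointConfig_subset_conicOf]
  constructor
  · rintro ⟨hq, h⟩
    obtain ⟨γ, rfl⟩ := eq_conicForm (b := b) (q := q) fun j => by
      obtain ⟨i, c, hc, hi⟩ := hb j
      have := h i
      rw [hi, QuadraticMap.map_smul] at this
      simpa [hc] using this
    refine ⟨γ, ?_, rfl, fun i => by rw [← conicForm_apply, h]⟩
    rintro rfl
    exact hq h0
  · rintro ⟨γ, hγ, rfl, h⟩
    refine ⟨fun h' => hγ (conicForm_injective (h'.trans h0.symm)), fun i => ?_⟩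
    rw [conicForm_apply, h]

/-- A conic through the three coordinate points is reducible if and only if one of its mixed
coefficients vanishes. -/
theorem isReducibleConic_conicForm_iff {γ : Fin 3 → ℂ} :
    IsReducibleConic (conicForm b γ) ↔ ∃ k, γ k = 0 := by
  constructor
  · rintro ⟨a, a', h⟩
    have h' : ∀ v, a v * a' v = γ ⬝ᵥ mixed (b.equivFun v) := fun v => by
      rw [← conicForm_apply, h]; rfl
    -- two of the three coordinate points lie on the same line of the conic
    have e0 := h' (b 0)
    have e1 := h' (b 1)
    have e2 := h' (b 2)
    have f0 := h' (b 1 + b 2)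
    have f1 := h' (b 0 + b 2)
    have f2 := h' (b 0 + b 1)
    simp [mixed, dotProduct, Fin.sum_univ_three] at e0 e1 e2 f0 f1 f2
    rcases e0 with e0 | e0 <;> rcases e1 with e1 | e1 <;> rcases e2 with e2 | e2 <;>
      simp only [e0, e1, e2, zero_mul, mul_zero, add_zero] at f0 f1 f2 <;>
      first
      | exact ⟨0, f0.symm⟩
      | exact ⟨1, f1.symm⟩
      | exact ⟨2, f2.symm⟩
  · rintro ⟨k, hk⟩
    fin_cases k
    · refine ⟨b.coord 0, γ 1 • b.coord 2 + γ 2 • b.coord 1, ?_⟩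
      ext v
      simp only [Fin.zero_eta] at hk
      simp [conicForm, hk]
      ring
    · refine ⟨b.coord 1, γ 0 • b.coord 2 + γ 2 • b.coord 0, ?_⟩
      ext v
      simp only [Fin.mk_one] at hk
      simp [conicForm, hk]
      ring
    · refine ⟨b.coord 2, γ 0 • b.coord 1 + γ 1 • b.coord 0, ?_⟩
      ext v
      simp only [Fin.reduceFinMk] at hk
      simp [conicForm, hk]
      ring

theorem IsConfigBasis.exists_of_isUniqueConic (hb : IsConfigBasis b ι)
    {q : QuadraticForm ℂ (Module.Dual ℂ W)} (hq : IsUniqueConic (pointConfig ι) q) :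
    ∃ α, α ≠ 0 ∧ q = conicForm b α ∧
      ∀ γ, (∀ i, γ ⬝ᵥ mixed (b.equivFun (coordForm ι i)) = 0) ↔ ∃ c : ℂ, γ = c • α := by
  obtain ⟨hq1, hq2⟩ := hq
  obtain ⟨α, hα, rfl, h⟩ := hb.liesOnConic_iff.1 hq1
  refine ⟨α, hα, rfl, fun γ => ⟨fun hγ => ?_, ?_⟩⟩
  · by_cases h0 : γ = 0
    · exact ⟨0, by rw [h0, zero_smul]⟩
    · obtain ⟨c, hc⟩ := hq2 _ (hb.liesOnConic_iff.2 ⟨γ, h0, rfl, hγ⟩)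
      exact ⟨c, conicForm_injective (by rw [hc, conicForm_smul])⟩
  · rintro ⟨c, rfl⟩ i
    rw [smul_dotProduct, h, smul_zero]

end Geometry

/-! ### Points of the configuration -/

section Points

variable {W : Type*} [AddCommGroup W] [Module ℂ W] {n : ℕ}
  {b : Module.Basis (Fin 3) ℂ (Module.Dual ℂ W)} {ι : W →ₗ[ℂ] (Fin (n + 1) → ℂ)}

/-- The coordinate points of a basis of the dual space. -/
noncomputable def basisPoint (b : Module.Basis (Fin 3) ℂ (Module.Dual ℂ W)) (j : Fin 3) :
    ℙ ℂ (Module.Dual ℂ W) := Projectivization.mk ℂ (b j) (b.ne_zero j)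

theorem mk_eq_basisPoint_iff {v : Module.Dual ℂ W} (hv : v ≠ 0) (j : Fin 3) :
    Projectivization.mk ℂ v hv = basisPoint b j ↔ ∀ k, k ≠ j → b.equivFun v k = 0 := by
  rw [basisPoint, Projectivization.mk_eq_mk_iff']
  constructor
  · rintro ⟨a, rfl⟩ k hk
    simp [hk.symm]
  · intro h
    refine ⟨b.equivFun v j, ?_⟩
    conv_rhs => rw [← b.sum_equivFun v]
    rw [Finset.sum_eq_single j (fun k _ hk => by rw [h k hk, zero_smul]) (by simp)]

theorem basisPoint_injective : Function.Injective (basisPoint b) := by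
  intro j k h
  by_contra hjk
  have := (mk_eq_basisPoint_iff (b.ne_zero j) k).1 h j hjk
  simp at this

theorem ncard_range_basisPoint : (Set.range (basisPoint b)).ncard = 3 := by
  rw [← Nat.card_coe_set_eq, Nat.card_range_of_injective basisPoint_injective, Nat.card_fin]

theorem IsConfigBasis.range_basisPoint_subset (hb : IsConfigBasis b ι) :
    Set.range (basisPoint b) ⊆ pointConfig ι := by
  rintro _ ⟨j, rfl⟩
  obtain ⟨i, c, hc, hi⟩ := hb j
  have h0 : coordForm ι i ≠ 0 := by
    rw [hi]
    exact smul_ne_zero hc (b.ne_zero j)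
  refine ⟨i, h0, ?_⟩
  rw [basisPoint, Projectivization.mk_eq_mk_iff']
  exact ⟨c⁻¹, by rw [hi, smul_smul, inv_mul_cancel₀ hc, one_smul]⟩

theorem pointConfig_finite : (pointConfig ι).Finite := by
  refine (Set.finite_range fun i : {i // coordForm ι i ≠ 0} =>
    Projectivization.mk ℂ (coordForm ι i) i.2).subset ?_
  rintro _ ⟨i, hi, rfl⟩
  exact ⟨⟨i, hi⟩, rfl⟩

theorem mk_mem_lineOf {V : Type*} [AddCommGroup V] [Module ℂ V] {a : Module.Dual ℂ V} {v : V}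
    (hv : v ≠ 0) : Projectivization.mk ℂ v hv ∈ lineOf a ↔ a v = 0 := by
  obtain ⟨c, hc⟩ := Projectivization.exists_smul_eq_mk_rep ℂ v hv
  change a (Projectivization.mk ℂ v hv).rep = 0 ↔ _
  rw [← hc, Units.smul_def, map_smul]
  simp

/-- The mixed products of a vector vanish if and only if it has at most one nonzero coordinate. -/
theorem mixed_eq_zero_iff {x : Fin 3 → ℂ} : mixed x = 0 ↔ ∃ j, ∀ k, k ≠ j → x k = 0 := by
  constructor
  · intro h
    have h0 : x 1 * x 2 = 0 := congrFun h 0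
    have h1 : x 0 * x 2 = 0 := congrFun h 1
    have h2 : x 0 * x 1 = 0 := congrFun h 2
    rcases mul_eq_zero.1 h0 with e | e
    · rcases mul_eq_zero.1 h1 with e' | e'
      · exact ⟨2, fun k hk => by fin_cases k <;> simp_all⟩
      · exact ⟨0, fun k hk => by fin_cases k <;> simp_all⟩
    · rcases mul_eq_zero.1 h2 with e' | e'
      · exact ⟨1, fun k hk => by fin_cases k <;> simp_all⟩
      · exact ⟨0, fun k hk => by fin_cases k <;> simp_all⟩
  · rintro ⟨j, hj⟩
    ext k
    fin_cases j <;> fin_cases k <;> simp [mixed, hj]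

theorem mixed_eq_zero_iff_mem {v : Module.Dual ℂ W} (hv : v ≠ 0) :
    mixed (b.equivFun v) = 0 ↔ Projectivization.mk ℂ v hv ∈ Set.range (basisPoint b) := by
  rw [mixed_eq_zero_iff]
  exact exists_congr fun j => (mk_eq_basisPoint_iff hv j).symm.trans eq_comm

theorem mixed_zero : mixed 0 = 0 := mixed_eq_zero_iff.2 ⟨0, fun _ _ => rfl⟩

theorem mixed_smul (c : ℂ) (x : Fin 3 → ℂ) : mixed (c • x) = c ^ 2 • mixed x := by
  ext k
  fin_cases k <;> simp [mixed] <;> ring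

/-- If the configuration has more than three points, one of them is not a coordinate point. -/
theorem exists_mixed_ne_zero (b : Module.Basis (Fin 3) ℂ (Module.Dual ℂ W))
    (h : 4 ≤ (pointConfig ι).ncard) : ∃ i, mixed (b.equivFun (coordForm ι i)) ≠ 0 := by
  by_contra! hi
  have : pointConfig ι ⊆ Set.range (basisPoint b) := by
    rintro _ ⟨i, hi0, rfl⟩
    exact (mixed_eq_zero_iff_mem hi0).1 (hi i)
  have := Set.ncard_le_ncard this (Set.finite_range _)
  rw [ncard_range_basisPoint] at this
  omega

theorem ne_zero_of_mixed_ne_zero {v : Module.Dual ℂ W} (h : mixed (b.equivFun v) ≠ 0) : v ≠ 0 := by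
  rintro rfl
  exact h (by rw [map_zero, mixed_zero])

theorem mixed_eq_zero_of_ncard_eq_three (hb : IsConfigBasis b ι) (h : (pointConfig ι).ncard = 3)
    (i : Fin (n + 1)) : mixed (b.equivFun (coordForm ι i)) = 0 := by
  by_cases hi : coordForm ι i = 0
  · rw [hi, map_zero, mixed_zero]
  · rw [mixed_eq_zero_iff_mem hi, Set.eq_of_subset_of_ncard_le hb.range_basisPoint_subset
      (by rw [h, ncard_range_basisPoint]) pointConfig_finite]
    exact ⟨i, hi, rfl⟩

/-! ### Several conics -/

/-- Two vectors of `ℂ³` that are orthogonal to the same two independent vectors are proportional. -/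
theorem mixed_mul_eq {α β m x : Fin 3 → ℂ} (hαβ : ∀ c : ℂ, β ≠ c • α) (hα : α ≠ 0)
    (hm2 : m 2 ≠ 0) (h1 : α ⬝ᵥ m = 0) (h2 : β ⬝ᵥ m = 0) (h3 : α ⬝ᵥ x = 0) (h4 : β ⬝ᵥ x = 0) :
    m 2 * x 0 = x 2 * m 0 ∧ m 2 * x 1 = x 2 * m 1 := by
  simp only [dotProduct, Fin.sum_univ_three] at h1 h2 h3 h4
  have hD : α 0 * β 1 - α 1 * β 0 ≠ 0 := by
    intro hD
    have hD1 : α 0 * β 2 - α 2 * β 0 = 0 := by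
      refine (mul_eq_zero.1 (?_ : m 2 * _ = 0)).resolve_left hm2
      linear_combination α 0 * h2 - β 0 * h1 - m 1 * hD
    have hD2 : α 1 * β 2 - α 2 * β 1 = 0 := by
      refine (mul_eq_zero.1 (?_ : m 2 * _ = 0)).resolve_left hm2
      linear_combination α 1 * h2 - β 1 * h1 + m 0 * hD
    obtain ⟨k, hk⟩ := Function.ne_iff.1 hα
    refine hαβ (β k / α k) ?_
    simp only [Pi.zero_apply] at hk
    ext l
    rw [Pi.smul_apply, smul_eq_mul, div_mul_eq_mul_div, eq_div_iff hk]
    fin_cases k <;> fin_cases l <;>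
      simp only [Fin.zero_eta, Fin.mk_one, Fin.reduceFinMk] <;>
      first
      | linear_combination hD
      | linear_combination -hD
      | linear_combination hD1
      | linear_combination -hD1
      | linear_combination hD2
      | linear_combination -hD2
  constructor
  · have : (α 0 * β 1 - α 1 * β 0) * (m 2 * x 0 - x 2 * m 0) = 0 := by
      linear_combination m 2 * (β 1 * h3 - α 1 * h4) - x 2 * (β 1 * h1 - α 1 * h2)
    linear_combination (mul_eq_zero.1 this).resolve_left hD
  · have : (α 0 * β 1 - α 1 * β 0) * (m 2 * x 1 - x 2 * m 1) = 0 := by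
      linear_combination m 2 * (α 0 * h4 - β 0 * h3) - x 2 * (α 0 * h2 - β 0 * h1)
    linear_combination (mul_eq_zero.1 this).resolve_left hD

/-- A point with no vanishing coordinate forms a general quadruple with the coordinate points. -/
theorem noThreeCollinear_insert {v : Module.Dual ℂ W} (hv : v ≠ 0)
    (h : ∀ k, b.equivFun v k ≠ 0) :
    NoThreeCollinear (insert (Projectivization.mk ℂ v hv) (Set.range (basisPoint b))) := by
  have hline : ∀ (a : Module.Dual ℂ (Module.Dual ℂ W)) j, basisPoint b j ∈ lineOf a ↔ a (b j) = 0 :=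
    fun a j => mk_mem_lineOf _
  -- a line through two coordinate points and a further point of the four is everything
  have key : ∀ (a : Module.Dual ℂ (Module.Dual ℂ W)), a ≠ 0 →
      (∀ j k, j ≠ k → a (b j) = 0 → a (b k) = 0 → a v ≠ 0) ∧ ∃ j, a (b j) ≠ 0 := by
    intro a ha
    have hav : a v = ∑ j, b.equivFun v j * a (b j) := by
      conv_lhs => rw [← b.sum_equivFun v]
      simp only [map_sum, map_smul, smul_eq_mul]
    have hex : ∃ j, a (b j) ≠ 0 := by
      by_contra! hall
      exact ha (b.ext (by simpa using hall))
    refine ⟨fun j k hjk hj hk hv0 => ?_, hex⟩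
    obtain ⟨l, hl⟩ := hex
    have hlj : l ≠ j := by rintro rfl; exact hl hj
    have hlk : l ≠ k := by rintro rfl; exact hl hk
    rw [hav, Finset.sum_eq_single l] at hv0
    · exact mul_ne_zero (h l) hl hv0
    · intro i _ hil
      have : i = j ∨ i = k := by omega
      rcases this with rfl | rfl
      · rw [hj, mul_zero]
      · rw [hk, mul_zero]
    · simp
  rintro p₁ (rfl | ⟨j₁, rfl⟩) p₂ (rfl | ⟨j₂, rfl⟩) p₃ (rfl | ⟨j₃, rfl⟩) h12 h13 h23
    ⟨a, ha, m1, m2, m3⟩ <;>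
    simp only [hline, mk_mem_lineOf, ne_eq, not_true_eq_false] at m1 m2 m3 h12 h13 h23
  · exact (key a ha).1 j₂ j₃ (fun e => h23 (by rw [e])) m2 m3 m1
  · exact (key a ha).1 j₁ j₃ (fun e => h13 (by rw [e])) m1 m3 m2
  · exact (key a ha).1 j₁ j₂ (fun e => h12 (by rw [e])) m1 m2 m3
  · obtain ⟨l, hl⟩ := (key a ha).2
    have e12 : j₁ ≠ j₂ := fun e => h12 (by rw [e])
    have e13 : j₁ ≠ j₃ := fun e => h13 (by rw [e])
    have e23 : j₂ ≠ j₃ := fun e => h23 (by rw [e])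
    have : l = j₁ ∨ l = j₂ ∨ l = j₃ := by omega
    rcases this with rfl | rfl | rfl <;> contradiction

theorem ncard_insert_range_basisPoint {v : Module.Dual ℂ W} (hv : v ≠ 0)
    (h : mixed (b.equivFun v) ≠ 0) :
    (insert (Projectivization.mk ℂ v hv) (Set.range (basisPoint b))).ncard = 4 := by
  rw [Set.ncard_insert_of_notMem (fun hmem => h ((mixed_eq_zero_iff_mem hv).2 hmem))
    (Set.finite_range _), ncard_range_basisPoint]

/-- The mixed parts of all points are proportional to one nonzero vector `m`. If `m` has no
vanishing entry, then there is only one point besides the coordinate points; otherwise `m` has a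
single nonzero entry, and all points but one lie on a coordinate line. -/
theorem IsConfigBasis.cases_of_several (hb : IsConfigBasis b ι)
    (hs : LiesOnSeveralConics (pointConfig ι)) :
    (pointConfig ι).ncard = 3 ∨ ((pointConfig ι).ncard = 4 ∧ NoThreeCollinear (pointConfig ι)) ∨
      (4 ≤ (pointConfig ι).ncard ∧ AllButOneCollinear (pointConfig ι)) := by
  have h3 := Set.ncard_le_ncard hb.range_basisPoint_subset pointConfig_finite
  rw [ncard_range_basisPoint] at h3
  rcases h3.eq_or_lt with h3 | h4
  · exact Or.inl h3.symm
  right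
  obtain ⟨i₀, hi₀⟩ := exists_mixed_ne_zero b h4
  -- renumber the basis such that the first two coordinates of the fourth point do not vanish
  obtain ⟨b, hb, hm2⟩ : ∃ b : Module.Basis (Fin 3) ℂ (Module.Dual ℂ W), IsConfigBasis b ι ∧
      mixed (b.equivFun (coordForm ι i₀)) 2 ≠ 0 := by
    obtain ⟨k, hk⟩ := Function.ne_iff.1 hi₀
    refine ⟨b.reindex (Equiv.swap k 2), hb.reindex _, ?_⟩
    simp only [mixed, Module.Basis.equivFun_apply, Module.Basis.repr_reindex_apply, Equiv.symm_swap]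
      at hk ⊢
    fin_cases k <;> simpa [Equiv.swap_apply_def, mul_comm] using hk
  obtain ⟨q, q', hq, hq', hne⟩ := hs
  obtain ⟨α, hα, rfl, hα'⟩ := hb.liesOnConic_iff.1 hq
  obtain ⟨β, hβ, rfl, hβ'⟩ := hb.liesOnConic_iff.1 hq'
  have hαβ : ∀ c : ℂ, β ≠ c • α := fun c hc => hne c (by rw [hc, conicForm_smul])
  have hprop := fun i => mixed_mul_eq hαβ hα hm2 (hα' i₀) (hβ' i₀) (hα' i) (hβ' i)
  set v := b.equivFun (coordForm ι i₀) with hv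
  have hm2' : v 0 * v 1 ≠ 0 := hm2
  have hv0 : v 0 ≠ 0 := left_ne_zero_of_mul hm2'
  have hv1 : v 1 ≠ 0 := right_ne_zero_of_mul hm2'
  have hne0 : mixed (b.equivFun (coordForm ι i₀)) ≠ 0 := fun h => hm2 (congrFun h 2)
  by_cases hv2 : v 2 = 0
  · right
    refine ⟨h4, basisPoint b 2, hb.range_basisPoint_subset ⟨2, rfl⟩, b.coord 2, ?_, ?_⟩
    · intro h
      have := congrArg (fun a => a (b 2)) h
      simp at this
    · rintro _ ⟨⟨i, hi, rfl⟩, hne2⟩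
      rw [mk_mem_lineOf]
      rw [Set.mem_singleton_iff, mk_eq_basisPoint_iff] at hne2
      by_contra h2
      obtain ⟨e0, e1⟩ := hprop i
      set x := b.equivFun (coordForm ι i) with hx
      have h2' : x 2 ≠ 0 := h2
      simp [mixed, hv2, hv0, hv1, h2'] at e0 e1
      refine hne2 fun k hk => ?_
      fin_cases k
      · exact e1
      · exact e0
      · exact absurd rfl hk
  · left
    have hZ : pointConfig ι = insert (Projectivization.mk ℂ (coordForm ι i₀)
        (ne_zero_of_mixed_ne_zero hne0)) (Set.range (basisPoint b)) := by
      refine Set.Subset.antisymm ?_ (Set.insert_subset ⟨i₀, _, rfl⟩ hb.range_basisPoint_subset)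
      rintro _ ⟨i, hi, rfl⟩
      rw [Set.mem_insert_iff, ← mixed_eq_zero_iff_mem hi]
      by_cases hxi : mixed (b.equivFun (coordForm ι i)) = 0
      · exact Or.inr hxi
      left
      obtain ⟨e0, e1⟩ := hprop i
      set x := b.equivFun (coordForm ι i) with hx
      simp only [mixed, Matrix.cons_val] at e0 e1
      have hx2 : x 0 * x 1 ≠ 0 := by
        intro h
        refine hxi ?_
        rw [h, zero_mul] at e0 e1
        ext k
        fin_cases k
        · exact (mul_eq_zero.1 e0).resolve_left hm2'
        · exact (mul_eq_zero.1 e1).resolve_left hm2'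
        · exact h
      have hx0 : x 0 ≠ 0 := left_ne_zero_of_mul hx2
      have hx1 : x 1 ≠ 0 := right_ne_zero_of_mul hx2
      have f0 : x 2 * v 0 = x 0 * v 2 := by
        refine mul_left_cancel₀ (mul_ne_zero hv1 hx1) ?_
        linear_combination e0
      have f1 : x 2 * v 1 = x 1 * v 2 := by
        refine mul_left_cancel₀ (mul_ne_zero hv0 hx0) ?_
        linear_combination e1
      rw [Projectivization.mk_eq_mk_iff']
      refine ⟨x 2 / v 2, b.equivFun.injective ?_⟩
      rw [map_smul, ← hv, ← hx]
      ext k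
      rw [Pi.smul_apply, smul_eq_mul, div_mul_eq_mul_div, div_eq_iff hv2]
      fin_cases k
      · exact f0
      · exact f1
      · rfl
    rw [hZ]
    refine ⟨ncard_insert_range_basisPoint _ hne0, noThreeCollinear_insert _ fun k => ?_⟩
    fin_cases k <;> assumption

end Points

/-! ### The defining ideal in the six cases -/

section Cases

variable {W : Type*} [AddCommGroup W] [Module ℂ W] {n : ℕ}
  {b : Module.Basis (Fin 3) ℂ (Module.Dual ℂ W)} {ι : W →ₗ[ℂ] (Fin (n + 1) → ℂ)}

theorem linearCombination_threeProducts (x : Fin 3 → ℂ) :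
    Fintype.linearCombination ℂ threeProducts x =
      x 0 • (X 1 * X 2) + x 1 • (X 0 * X 2) + x 2 • (X 0 * X 1) := by
  simp [Fintype.linearCombination_apply, Fin.sum_univ_three, threeProducts]

theorem IsConfigBasis.minimallyGenerated_of_no_conic [FiniteDimensional ℂ W]
    (hb : IsConfigBasis b ι) (hι : Function.Injective ι)
    (h : ¬ ∃ q, LiesOnConic (pointConfig ι) q) :
    5 ≤ n ∧ MinimallyGenerated (definingIdeal (coordPower (linearSpace ι hι) 2)) (n - 5) 6 2 := by
  refine hb.minimallyGenerated hι (N := fun k => Pi.single k 1) (fun γ => ?_)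
    (fun k => (Fintype.linearCombination_apply_single ℂ threeProducts k 1 |>.trans
      (one_smul ℂ _)).symm) le_rfl threeProductsRel_isHomogeneous ker_threeProducts
    linearIndependent_threeProductsRel
  simp only [dotProduct_single_one]
  constructor
  · intro hγ k
    by_contra hk
    exact h ⟨_, hb.liesOnConic_iff.2 ⟨γ, fun h0 => hk (congrFun h0 k), rfl, hγ⟩⟩
  · intro hγ i
    rw [show γ = 0 from funext hγ, zero_dotProduct]

theorem IsConfigBasis.minimallyGenerated_of_irreducible [FiniteDimensional ℂ W]
    (hb : IsConfigBasis b ι) (hι : Function.Injective ι)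
    {q : QuadraticForm ℂ (Module.Dual ℂ W)} (hq : IsUniqueConic (pointConfig ι) q)
    (hirr : ¬ IsReducibleConic q) :
    4 ≤ n ∧ MinimallyGenerated (definingIdeal (coordPower (linearSpace ι hι) 2)) (n - 4) 7 3 := by
  obtain ⟨α, -, hqα, -⟩ := hb.exists_of_isUniqueConic hq
  rw [hqα, isReducibleConic_conicForm_iff] at hirr
  push Not at hirr
  -- rescale the basis to make the three coefficients of the conic equal
  have hb' := hb.isUnitSMul (fun j => (hirr j).isUnit)
  obtain ⟨α', hα', hqα', hγ'⟩ := hb'.exists_of_isUniqueConic hq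
  have hb'j := Module.Basis.isUnitSMul_apply (v := b) fun j => (hirr j).isUnit
  have hqq : ∀ v, conicForm (b.isUnitSMul fun j => (hirr j).isUnit) α' v = conicForm b α v :=
    fun v => by rw [← hqα', hqα]
  obtain ⟨e0, e1, e2⟩ := conicForm_basis (b := b.isUnitSMul fun j => (hirr j).isUnit) α' 1 1
  simp only [hqq, one_smul, hb'j, conicForm_basis] at e0 e1 e2
  have e01 : α' 0 = α' 1 := by linear_combination e1 - e0
  have e12 : α' 1 = α' 2 := by linear_combination e2 - e1
  refine hb'.minimallyGenerated hι (N := ![![1, -1, 0], ![0, 1, -1]]) (fun γ => ?_)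
    (fun k => ?_) (by norm_num) irreduciblePairRel_isHomogeneous ker_irreduciblePair
    linearIndependent_irreduciblePairRel
  · rw [hγ', Fin.forall_fin_two]
    simp only [dotProduct, Fin.sum_univ_three, Matrix.cons_val]
    have h0 : α' 0 ≠ 0 := by
      intro h0
      refine hα' (funext fun k => ?_)
      fin_cases k
      · exact h0
      · exact e01.symm.trans h0
      · exact (e01.trans e12).symm.trans h0
    constructor
    · rintro ⟨c, rfl⟩
      simp only [Pi.smul_apply, smul_eq_mul, ← e12, ← e01]
      constructor <;> ring
    · rintro ⟨h1, h2⟩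
      refine ⟨γ 0 / α' 0, funext fun k => ?_⟩
      rw [Pi.smul_apply, smul_eq_mul, div_mul_eq_mul_div, eq_div_iff h0]
      fin_cases k
      · rfl
      · simp only [Fin.mk_one, ← e01]
        linear_combination -(α' 0) * h1
      · simp only [Fin.reduceFinMk, ← e12, ← e01]
        linear_combination -(α' 0) * (h1 + h2)
  · rw [linearCombination_threeProducts]
    fin_cases k <;> simp [irreduciblePair, sub_eq_add_neg]

theorem IsConfigBasis.isCompleteIntersection_of_reducible [FiniteDimensional ℂ W]
    (hb : IsConfigBasis b ι) (hι : Function.Injective ι)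
    {q : QuadraticForm ℂ (Module.Dual ℂ W)} (hq : IsUniqueConic (pointConfig ι) q)
    (hred : IsReducibleConic q) :
    4 ≤ n ∧ IsCompleteIntersection
      (definingIdeal (coordPower (linearSpace ι hι) 2)) (n - 4) 2 2 := by
  obtain ⟨α, -, hqα, -⟩ := hb.exists_of_isUniqueConic hq
  -- renumber the basis such that the last mixed coefficient of the conic vanishes
  obtain ⟨b', hb', hq'⟩ : ∃ b' : Module.Basis (Fin 3) ℂ (Module.Dual ℂ W), IsConfigBasis b' ι ∧
      q (b' 0 + b' 1) = 0 := by
    obtain ⟨k, hk⟩ := isReducibleConic_conicForm_iff.1 (hqα ▸ hred)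
    refine ⟨b.reindex (Equiv.swap k 2), hb.reindex _, ?_⟩
    rw [hqα, conicForm_apply]
    fin_cases k <;>
      simpa [mixed, dotProduct, Fin.sum_univ_three, Equiv.swap_apply_def] using hk
  obtain ⟨α', hα', hqα', hγ'⟩ := hb'.exists_of_isUniqueConic hq
  have e2 : α' 2 = 0 := by
    rw [hqα', conicForm_apply] at hq'
    simpa [mixed, dotProduct, Fin.sum_univ_three] using hq'
  have h0 : α' 0 ≠ 0 ∨ α' 1 ≠ 0 := by
    by_contra! h
    refine hα' (funext fun k => ?_)
    fin_cases k
    · exact h.1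
    · exact h.2
    · exact e2
  rw [definingIdeal_coordPower_eq_ker b']
  refine isCompleteIntersection_ker_aeval h0 (hb'.span_coordSquares
    (N := ![![0, 0, 1], ![α' 1, -α' 0, 0]]) (fun γ => ?_) fun k => ?_)
  · rw [hγ', Fin.forall_fin_two]
    simp only [dotProduct, Fin.sum_univ_three, Matrix.cons_val]
    constructor
    · rintro ⟨c, rfl⟩
      simp only [Pi.smul_apply, smul_eq_mul, e2]
      constructor <;> ring
    · rintro ⟨h1, h2⟩
      rcases h0 with h0 | h0
      · refine ⟨γ 0 / α' 0, funext fun k => ?_⟩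
        rw [Pi.smul_apply, smul_eq_mul, div_mul_eq_mul_div, eq_div_iff h0]
        fin_cases k
        · rfl
        · simp only [Fin.mk_one]
          linear_combination -h2
        · simp only [Fin.reduceFinMk, e2]
          linear_combination α' 0 * h1
      · refine ⟨γ 1 / α' 1, funext fun k => ?_⟩
        rw [Pi.smul_apply, smul_eq_mul, div_mul_eq_mul_div, eq_div_iff h0]
        fin_cases k
        · simp only [Fin.zero_eta]
          linear_combination h2
        · rfl
        · simp only [Fin.reduceFinMk, e2]
          linear_combination α' 1 * h1
  · rw [linearCombination_threeProducts]
    fin_cases k <;> simp [reduciblePair, sub_eq_add_neg, smul_eq_C_mul]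

theorem IsConfigBasis.minimallyGenerated_of_ncard_eq_three [FiniteDimensional ℂ W]
    (hb : IsConfigBasis b ι) (hι : Function.Injective ι) (h : (pointConfig ι).ncard = 3) :
    2 ≤ n ∧ MinimallyGenerated (definingIdeal (coordPower (linearSpace ι hι) 2)) (n - 2) 0 2 :=
  hb.minimallyGenerated hι (N := Fin.elim0) (m := Fin.elim0)
    (fun γ => by simp only [mixed_eq_zero_of_ncard_eq_three hb h, dotProduct_zero]; simp)
    (fun k => k.elim0) le_rfl
    (g := Fin.elim0) (fun i => i.elim0) (ker_squares _) linearIndependent_empty_type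

theorem IsConfigBasis.minimallyGenerated_of_general_quadruple [FiniteDimensional ℂ W]
    (hb : IsConfigBasis b ι) (hι : Function.Injective ι) (h4 : (pointConfig ι).ncard = 4)
    (hgen : NoThreeCollinear (pointConfig ι)) :
    3 ≤ n ∧ MinimallyGenerated (definingIdeal (coordPower (linearSpace ι hι) 2)) (n - 3) 1 4 := by
  obtain ⟨i₀, hi₀⟩ := exists_mixed_ne_zero b h4.ge
  have hne := ne_zero_of_mixed_ne_zero hi₀
  have hP := hb.range_basisPoint_subset
  have hnot : Projectivization.mk ℂ _ hne ∉ Set.range (basisPoint b) := fun hmem =>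
    hi₀ ((mixed_eq_zero_iff_mem hne).2 hmem)
  have hcoord : ∀ k, b.equivFun (coordForm ι i₀) k ≠ 0 := by
    intro k hk
    obtain ⟨j₁, j₂, h1, h2, h12⟩ : ∃ j₁ j₂ : Fin 3, j₁ ≠ k ∧ j₂ ≠ k ∧ j₁ ≠ j₂ := by
      fin_cases k
      · exact ⟨1, 2, by decide⟩
      · exact ⟨0, 2, by decide⟩
      · exact ⟨0, 1, by decide⟩
    refine hgen _ (hP ⟨j₁, rfl⟩) _ (hP ⟨j₂, rfl⟩) _ ⟨i₀, hne, rfl⟩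
      (fun e => h12 (basisPoint_injective e)) (fun e => hnot ⟨j₁, e⟩) (fun e => hnot ⟨j₂, e⟩)
      ⟨b.coord k, fun h0 => ?_, (mk_mem_lineOf _).2 ?_, (mk_mem_lineOf _).2 ?_,
        (mk_mem_lineOf hne).2 hk⟩
    · have := congrArg (fun a => a (b k)) h0
      simp at this
    · simp [h1]
    · simp [h2]
  have hZ : insert (Projectivization.mk ℂ _ hne) (Set.range (basisPoint b)) = pointConfig ι :=
    Set.eq_of_subset_of_ncard_le (Set.insert_subset ⟨i₀, hne, rfl⟩ hP)
      (by rw [h4, ncard_insert_range_basisPoint hne hi₀]) pointConfig_finite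
  -- rescale the basis such that the fourth point has coordinates `(1, 1, 1)`
  have hu := fun j => (hcoord j).isUnit
  have hone : (b.isUnitSMul hu).equivFun (coordForm ι i₀) = 1 := by
    ext j
    rw [Module.Basis.equivFun_apply, Module.Basis.repr_isUnitSMul, Units.smul_def,
      Units.val_inv_eq_inv_val, IsUnit.unit_spec, smul_eq_mul, ← Module.Basis.equivFun_apply]
    exact inv_mul_cancel₀ (hcoord j)
  have hrange : Set.range (basisPoint (b.isUnitSMul hu)) = Set.range (basisPoint b) := by
    congr 1
    funext j
    rw [basisPoint, basisPoint, Projectivization.mk_eq_mk_iff']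
    exact ⟨_, (Module.Basis.isUnitSMul_apply hu j).symm⟩
  have hmix1 : mixed 1 = 1 := by
    ext k
    fin_cases k <;> simp [mixed]
  refine (hb.isUnitSMul hu).minimallyGenerated hι (N := fun _ : Fin 1 => 1) (fun γ => ?_)
    (fun k => ?_) (by norm_num) sumProductsRel_isHomogeneous ker_sumProducts
    linearIndependent_sumProductsRel
  · constructor
    · intro h _
      simpa only [hone, hmix1] using h i₀
    · intro h i
      by_cases hi : coordForm ι i = 0
      · rw [hi, map_zero, mixed_zero, dotProduct_zero]
      have hmem : Projectivization.mk ℂ _ hi ∈ pointConfig ι := ⟨i, hi, rfl⟩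
      rw [← hZ, Set.mem_insert_iff] at hmem
      rcases hmem with hmem | hmem
      · obtain ⟨a, ha⟩ := (Projectivization.mk_eq_mk_iff' ℂ _ _ _ _).1 hmem
        rw [← ha, map_smul, hone, mixed_smul, hmix1, dotProduct_smul, h 0, smul_zero]
      · rw [← hrange] at hmem
        rw [(mixed_eq_zero_iff_mem hi).2 hmem, dotProduct_zero]
  · rw [linearCombination_threeProducts]
    simp [sumProducts]

theorem IsConfigBasis.minimallyGenerated_of_allButOneCollinear [FiniteDimensional ℂ W]
    (hb : IsConfigBasis b ι) (hι : Function.Injective ι) (h4 : 4 ≤ (pointConfig ι).ncard)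
    (hcol : AllButOneCollinear (pointConfig ι)) :
    3 ≤ n ∧ MinimallyGenerated (definingIdeal (coordPower (linearSpace ι hι) 2)) (n - 3) 1 2 := by
  obtain ⟨p₀, -, a, ha, hline⟩ := hcol
  -- the exceptional point is a coordinate point, which may be assumed to be the last one
  obtain ⟨b, hb, rfl⟩ : ∃ b : Module.Basis (Fin 3) ℂ (Module.Dual ℂ W), IsConfigBasis b ι ∧
      p₀ = basisPoint b 2 := by
    obtain ⟨j, hj⟩ : ∃ j, p₀ = basisPoint b j := by
      by_contra! hall
      refine ha (b.ext fun j => ?_)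
      exact (mk_mem_lineOf (b.ne_zero j)).1
        (hline ⟨hb.range_basisPoint_subset ⟨j, rfl⟩, fun e => hall j e.symm⟩)
    refine ⟨b.reindex (Equiv.swap j 2), hb.reindex _, ?_⟩
    rw [hj]
    simp [basisPoint]
  have hab : ∀ j, j ≠ 2 → a (b j) = 0 := fun j hj => (mk_mem_lineOf (b.ne_zero j)).1
    (hline ⟨hb.range_basisPoint_subset ⟨j, rfl⟩, fun e => hj (basisPoint_injective e)⟩)
  have ha2 : a (b 2) ≠ 0 := by
    intro h2
    refine ha (b.ext fun j => ?_)
    by_cases hj : j = 2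
    · rw [hj, h2, LinearMap.zero_apply]
    · rw [hab j hj, LinearMap.zero_apply]
  have hav : ∀ v, a v = b.equivFun v 2 * a (b 2) := by
    intro v
    conv_lhs => rw [← b.sum_equivFun v]
    rw [Fin.sum_univ_three, map_add, map_add, map_smul, map_smul, map_smul, hab 0 (by decide),
      hab 1 (by decide), smul_zero, smul_zero, zero_add, zero_add, smul_eq_mul]
  have hmix : ∀ i, mixed (b.equivFun (coordForm ι i)) 0 = 0 ∧
      mixed (b.equivFun (coordForm ι i)) 1 = 0 := by
    intro i
    by_cases hi : coordForm ι i = 0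
    · simp [hi, mixed]
    by_cases hi2 : Projectivization.mk ℂ _ hi = basisPoint b 2
    · rw [mk_eq_basisPoint_iff] at hi2
      simp only [mixed, Matrix.cons_val, hi2 0 (by decide), hi2 1 (by decide), zero_mul, and_self]
    · have := (mk_mem_lineOf hi).1 (hline ⟨⟨i, hi, rfl⟩, hi2⟩)
      rw [hav] at this
      simp only [mixed, Matrix.cons_val, (mul_eq_zero.1 this).resolve_right ha2, mul_zero, and_self]
  obtain ⟨i₀, hi₀⟩ := exists_mixed_ne_zero b h4
  have hi₂ : mixed (b.equivFun (coordForm ι i₀)) 2 ≠ 0 := by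
    intro h2
    refine hi₀ (funext fun k => ?_)
    fin_cases k
    · exact (hmix i₀).1
    · exact (hmix i₀).2
    · exact h2
  refine hb.minimallyGenerated hι (N := fun _ : Fin 1 => ![0, 0, 1]) (fun γ => ?_)
    (fun k => ?_) le_rfl oneProductRel_isHomogeneous ker_oneProduct
    linearIndependent_oneProductRel
  · simp only [dotProduct, Fin.sum_univ_three, hmix, Matrix.cons_val, mul_zero, zero_add, mul_one]
    exact ⟨fun h _ => (mul_eq_zero.1 (h i₀)).resolve_right hi₂, fun h i => by rw [h 0, zero_mul]⟩
  · rw [linearCombination_threeProducts]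
    simp [oneProduct]

end Cases

theorem mainTheorem8 {W : Type*} [AddCommGroup W] [Module ℂ W] (hW : Module.finrank ℂ W = 3)
    (n : ℕ) (ι : W →ₗ[ℂ] (Fin (n + 1) → ℂ)) (hι : Function.Injective ι)
    (Z : Set (Projectivization ℂ (Module.Dual ℂ W))) (hZ : Z = pointConfig ι)
    (L : Set (ProjSpace n)) (hL : L = linearSpace ι hι)
    (I : Ideal (CoordRing n)) (hI : I = definingIdeal (coordPower L 2)) :
    -- (i) no conic through `Z`
    ((¬ ∃ q, LiesOnConic Z q) → 5 ≤ n ∧ MinimallyGenerated I (n - 5) 6 2) ∧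
    -- (ii) a unique conic through `Z`, irreducible or reducible
    (∀ q, IsUniqueConic Z q →
      (¬ IsReducibleConic q → 4 ≤ n ∧ MinimallyGenerated I (n - 4) 7 3) ∧
      (IsReducibleConic q → 4 ≤ n ∧ IsCompleteIntersection I (n - 4) 2 2)) ∧
    -- (iii) several conics through `Z`: one of the three cases below occurs
    (LiesOnSeveralConics Z →
      Z.ncard = 3 ∨ (Z.ncard = 4 ∧ NoThreeCollinear Z) ∨
        (4 ≤ Z.ncard ∧ AllButOneCollinear Z)) ∧
    (Z.ncard = 3 → 2 ≤ n ∧ MinimallyGenerated I (n - 2) 0 2) ∧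
    (Z.ncard = 4 ∧ NoThreeCollinear Z → 3 ≤ n ∧ MinimallyGenerated I (n - 3) 1 4) ∧
    (4 ≤ Z.ncard ∧ AllButOneCollinear Z → 3 ≤ n ∧ MinimallyGenerated I (n - 3) 1 2) := by
  subst hZ hL hI
  have : FiniteDimensional ℂ W := Module.finite_of_finrank_pos (by omega)
  obtain ⟨b, hb⟩ := exists_isConfigBasis hW hι
  exact ⟨hb.minimallyGenerated_of_no_conic hι,
    fun q hq => ⟨hb.minimallyGenerated_of_irreducible hι hq,
      hb.isCompleteIntersection_of_reducible hι hq⟩,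
    hb.cases_of_several,
    hb.minimallyGenerated_of_ncard_eq_three hι,
    fun h => hb.minimallyGenerated_of_general_quadruple hι h.1 h.2,
    fun h => hb.minimallyGenerated_of_allButOneCollinear hι h.1 h.2⟩
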